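/- All Hilbert spaces are finite-dimensional and all logarithms are to base 2. **Notation.** For subnormalized states $\rho,\sigma\ge 0$ (trace at most $1$) put $F(\rho,\sigma)=\|\sqrt\rho\sqrt\sigma\|_1$, $\bar F(\rho,\sigma)=F(\rho,\sigma)+\sqrt{(1-\mathrm{tr}\,\rho)(1-\mathrm{tr}\,\sigma)}$, let $P(\rho,\sigma)=\sqrt{1-\bar F(\rho,\sigma)^2}$ be the purified distance, and let $\mathcal B^{\varepsilon}(\rho)$ be the set of subnormalized states $\bar\rho$ with $P(\bar\rho,\rho)\le\varepsilon$. Let $$D_{\max}(\rho\|\sigma)=\inf\{\lambda\in\mathbb R: 2^{\lambda}\sigma\ge\rho\},\qquad I_{\max}^{\varepsilon}(A:B)_\rho=\inf_{\bar\rho_{AB}\in\mathcal B^{\varepsilon}(\rho_{AB})}\ \inf_{\sigma_B\ \text{a state}} D_{\max}(\bar\rho_{AB}\|\bar\rho_A\otimes\sigma_B),$$ $$H_0^{\varepsilon}(A)_\rho=\inf_{\bar\rho_A\in\mathcal B^{\varepsilon}(\rho_A)}\log\mathrm{rank}(\bar\rho_A).$$ A pure state $\rho_{AX_AX_{A'}R}$,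 where $X_A$ and $X_{A'}$ carry the same orthonormal basis $\{|x\rangle\}$, is *classically coherent* on $X_AX_{A'}$ with respect to this basis if it is the projector onto a vector $\sum_x\sqrt{p_x}\,|x\rangle_{X_A}|x\rangle_{X_{A'}}\otimes|\psi_x\rangle_{AR}$ with a probability distribution $(p_x)$ and unit vectors $|\psi_x\rangle$. A *classical $\delta$-error state splitting protocol* for $\rho_{AX_AX_{A'}R}$ with classical communication cost $c\in\mathbb N$ and shared randomness of size $S\ge 1$ consists of the following steps. Alice (who holds $AX_AX_{A'}$) and Bob share the state $\frac1S\sum_{b=1}^S|b\rangle\langle b|\otimes|b\rangle\langle b|$. Alice applies a quantum channel to $AX_AX_{A'}$ and her share, with output systems $A$, $X_A$ and a register of $c$ bits. This register is sent to Bob through a classical channel. Bob applies a quantum channel to the received bits and his share, with output $X_B\cong X_{A'}$. The resulting state $\omega_{AX_AX_BR}$ is required to satisfy $$P\Big(\omega_{AX_AX_BR},\ \sum_x\langle x|\rho_{AX_AX_{A'}R}|x\rangle_{X_{A'}}\otimes|x\rangle\langle x|_{X_B}\Big)\le\delta .$$ Its shared randomness cost is $s=\lceil\log S\rceil$. **Theorem.**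 Let $0<\varepsilon\le 1$ and $0\le\varepsilon'<1$, let $|X_{A'}|\ge 2$, and let $\rho_{AX_AX_{A'}R}$ be a pure state that is classically coherent on $X_AX_{A'}$ with respect to the basis $\{|x\rangle\}$. Then there exists a classical $\big(\varepsilon+\varepsilon'+\sqrt{8\varepsilon'}+|X_{A'}|^{-1/2}\big)$-error state splitting protocol for $\rho_{AX_AX_{A'}R}$ whose classical communication cost $c$ and shared randomness cost $s$ satisfy $$c\le I_{\max}^{\varepsilon'}(X_{A'}:R)_\rho+4\log\frac1\varepsilon+4+\log\log|X_{A'}|,$$ $$c+s\le H_0^{\varepsilon'}(X_{A'})_\rho+2+\log\log|X_{A'}|.$$ -/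

import Mathlib

open scoped ComplexOrder MatrixOrder Kronecker

noncomputable section

namespace StateSplitting

/-! A finite-dimensional system is `ℂ^n` for a finite index type `n`; a composite system is indexed by
the product type and operators are square complex matrices. -/

/-- Operators on the system `n`. -/
abbrev Op (n : Type*) := Matrix n n ℂ

section States

variable {n : Type*} [Fintype n]

/-- Density operators. -/
def IsState (ρ : Op n) : Prop := ρ.PosSemidef ∧ ρ.trace = 1

/-- Subnormalized states. -/
def IsSubState (ρ : Op n) : Prop := ρ.PosSemidef ∧ ρ.trace.re ≤ 1

/-- Pure-state density operators. -/
def IsPureState (ρ : Op n) : Prop := IsState ρ ∧ (ρ * ρ).trace = 1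

variable [DecidableEq n]

/-- The trace norm `tr √(Γ Γ†)`. -/
def traceNorm (Γ : Op n) : ℝ := (CFC.sqrt (Γ * Γ.conjTranspose)).trace.re

/-- The fidelity `‖√ρ √σ‖₁`. -/
def fidelity (ρ σ : Op n) : ℝ := traceNorm (CFC.sqrt ρ * CFC.sqrt σ)

/-- The generalized fidelity of subnormalized states. -/
def genFidelity (ρ σ : Op n) : ℝ :=
  fidelity ρ σ + Real.sqrt ((1 - ρ.trace.re) * (1 - σ.trace.re))

/-- The purified distance. -/
def purifiedDistance (ρ σ : Op n) : ℝ := Real.sqrt (1 - genFidelity ρ σ ^ 2)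

/-- The ball of subnormalized states around `ρ` in purified distance. -/
def smoothingBall (ε : ℝ) (ρ : Op n) : Set (Op n) :=
  {τ | IsSubState τ ∧ purifiedDistance τ ρ ≤ ε}

end States

section Entropies

variable {m n : Type*}

/-- Partial trace over the left factor. -/
def traceLeft [Fintype m] (ρ : Op (m × n)) : Op n := fun i j => ∑ k, ρ (k, i) (k, j)

/-- Partial trace over the right factor. -/
def traceRight [Fintype n] (ρ : Op (m × n)) : Op m := fun i j => ∑ k, ρ (i, k) (j, k)

/-- The max-relative entropy `inf {r ∈ ℝ : 2^r σ ≥ ρ}` (`⊤` if there is no such `r`). -/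
def dMax (ρ σ : Op n) : EReal :=
  ⨅ (r : ℝ) (_ : (((2 : ℝ) ^ r) • σ - ρ).PosSemidef), (r : EReal)

/-- The max-information that the right factor has about the left one. -/
def iMax [Fintype m] [Fintype n] (ρ : Op (m × n)) : EReal :=
  ⨅ (σ : Op n) (_ : IsState σ), dMax ρ (traceRight ρ ⊗ₖ σ)

/-- The smooth max-information. -/
def smoothIMax [Fintype m] [Fintype n] [DecidableEq m] [DecidableEq n]
    (ε : ℝ) (ρ : Op (m × n)) : EReal :=
  ⨅ τ ∈ smoothingBall ε ρ, iMax τ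

/-- The zero-Rényi entropy `log₂ rank ρ`, with `log₂ 0 = -∞`. -/
def hZero [Fintype n] (ρ : Op n) : EReal :=
  if ρ.rank = 0 then ⊥ else ((Real.logb 2 ρ.rank : ℝ) : EReal)

/-- The smooth zero-Rényi entropy. -/
def smoothHZero [Fintype n] [DecidableEq n] (ε : ℝ) (ρ : Op n) : EReal :=
  ⨅ τ ∈ smoothingBall ε ρ, hZero τ

end Entropies

section Channels

variable {m n k : Type*}

/-- `Φ ⊗ id_k`, applied to an operator on the composite system. -/
def ampliate (Φ : Op n →ₗ[ℂ] Op m) (ρ : Op (n × k)) : Op (m × k) :=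
  fun i j => Φ (fun a b => ρ (a, i.2) (b, j.2)) i.1 j.1

/-- Quantum channels: completely positive and trace-preserving linear maps. -/
def IsChannel [Fintype m] [Fintype n] (Φ : Op n →ₗ[ℂ] Op m) : Prop :=
  (∀ (d : ℕ) (ρ : Op (n × Fin d)), ρ.PosSemidef → (ampliate Φ ρ).PosSemidef) ∧
    ∀ ρ : Op n, (Φ ρ).trace = ρ.trace

/-- The measurement of the register `f` in its computational basis, with the outcome kept in that
register: `ρ ↦ ∑ₓ |x⟩⟨x|_f ρ |x⟩⟨x|_f`. -/
def dephase [DecidableEq k] (f : n → k) (ρ : Op n) : Op n :=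
  fun i j => if f i = f j then ρ i j else 0

/-- Shared randomness of size `S`: the state `S⁻¹ ∑_b |b⟩⟨b| ⊗ |b⟩⟨b|`. -/
def sharedRandomness (S : ℕ) : Op (Fin S × Fin S) :=
  Matrix.diagonal fun b => if b.1 = b.2 then (S : ℂ)⁻¹ else 0

end Channels

section Splitting

variable {A X R : Type*}

/-- `ρ` on the systems `A X_A X_A' R` (indexed in this order by `A × X × X × R`) is the projector
onto `∑ₓ √pₓ |x x⟩_{X_A X_A'} ⊗ |ψₓ⟩_{AR}` with a probability distribution `p` and unit vectors
`ψₓ`: it is classically coherent on `X_A X_A'` with respect to the basis `|x⟩`. -/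
def IsClassicallyCoherent [Fintype A] [Fintype X] [Fintype R] [DecidableEq X]
    (ρ : Op (A × X × X × R)) : Prop :=
  ∃ (p : X → ℝ) (ψ : X → A × R → ℂ),
    (∀ x, 0 ≤ p x) ∧ ∑ x, p x = 1 ∧ (∀ x, ∑ i, ‖ψ x i‖ ^ 2 = 1) ∧
    let v : A × X × X × R → ℂ := fun (a, x, x', r) =>
      if x = x' then (Real.sqrt (p x) : ℂ) * ψ x (a, r) else 0
    ρ = Matrix.vecMulVec v (star v)

/-- A message of `c` bits. -/
abbrev Bits (c : ℕ) := Fin c → Bool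

/-- A one-way protocol for Alice, who holds `A X_A X_A'`, and Bob, who end up with `A X_A` and
`X_B`. It uses shared randomness of size `S` and `c` bits of communication from Alice to Bob:
Alice's local operation acts on `A X_A X_A'` and her share of the randomness and outputs `A X_A` and
the message; Bob's acts on the message and his share and outputs `X_B`. -/
structure Protocol (A X : Type*) [Fintype A] [Fintype X] (c S : ℕ) where
  alice : Op (A × X × X × Fin S) →ₗ[ℂ] Op (A × X × Bits c)
  alice_isChannel : IsChannel alice
  bob : Op (Bits c × Fin S) →ₗ[ℂ] Op X
  bob_isChannel : IsChannel bob

namespace Protocol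

variable [Fintype A] [Fintype X] {c S : ℕ} (P : Protocol A X c S)

/-- The systems `A X_A X_A' R` together with the shared randomness, grouped into Alice's systems and
the remaining ones (`R` and Bob's share). -/
def initial (S : ℕ) (ρ : Op (A × X × X × R)) : Op ((A × X × X × Fin S) × (R × Fin S)) :=
  (ρ ⊗ₖ sharedRandomness S).submatrix
    (fun ((a, x, x', b), (r, b')) => ((a, x, x', r), (b, b')))
    (fun ((a, x, x', b), (r, b')) => ((a, x, x', r), (b, b')))

/-- The state after Alice's operation and the transmission of the message through a classical
channel, which measures it in the computational basis. -/
def afterMessage (ρ : Op (A × X × X × R)) : Op ((A × X × Bits c) × (R × Fin S)) :=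
  dephase (fun i => i.1.2.2) (ampliate P.alice (initial S ρ))

/-- The state that the protocol outputs on `A X_A X_B R`. -/
def output (ρ : Op (A × X × X × R)) : Op (A × X × X × R) :=
  (ampliate P.bob
    ((P.afterMessage ρ).submatrix
      (fun ((w, b'), (a, x, r)) => ((a, x, w), (r, b')))
      (fun ((w, b'), (a, x, r)) => ((a, x, w), (r, b'))))).submatrix
    (fun (a, x, x', r) => (x', (a, x, r)))
    (fun (a, x, x', r) => (x', (a, x, r)))

/-- The protocol is a classical state splitting of `ρ` with error `δ`: its output is `δ`-close in
purified distance to `∑ₓ ⟨x|ρ|x⟩_{X_A'} ⊗ |x⟩⟨x|_{X_B}`. -/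
def IsClassicalStateSplitting [Fintype R] [DecidableEq A] [DecidableEq X] [DecidableEq R]
    (ρ : Op (A × X × X × R)) (δ : ℝ) : Prop :=
  purifiedDistance (P.output ρ) (dephase (fun (_, _, x', _) => x') ρ) ≤ δ

end Protocol

/-- The shared randomness cost `⌈log₂ S⌉` of shared randomness of size `S`. -/
def randomnessCost (S : ℕ) : ℕ := ⌈Real.logb 2 S⌉₊

/-- The reduced state on `X_A' R`. -/
def reducedXR [Fintype A] [Fintype X] (ρ : Op (A × X × X × R)) : Op (X × R) :=
  traceLeft (traceLeft ρ)

/-- The reduced state on `X_A'`. -/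
def reducedX [Fintype A] [Fintype X] [Fintype R] (ρ : Op (A × X × X × R)) : Op X :=
  traceRight (reducedXR ρ)

end Splitting

end StateSplitting

end

open StateSplitting

set_option linter.unusedSectionVars false
set_option linter.unusedDecidableInType false
set_option linter.unusedFintypeInType false

/-! The source is the vector `∑ₓ |x x⟩ ⊗ Ψₓ`, with `Ψₓ` an operator from `A` to `R` of squared
Hilbert–Schmidt norm `pₓ`. A code labels the cells `(k, b)` of a table (message times shared value)
by `g (k, b)` in `X`, with weights `w (k, b)`. Given `b`, Alice aims at the block vector `∑ₖ √(S w)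
|k⟩ |g⟩ Ψ_g`, and Bob outputs `g (k, b)`. If the weights of the cells labelled `x` sum to one for
every `x`, the average over `b` is exactly the target. Alice holds everything but `R`, so an Uhlmann
argument (`exists_contr_hs_eq`) lets her reach a block up to the distance between the square roots
of its `R`-marginal and of the full `R`-marginal. It remains to find a code whose blocks have nearly
the right marginal on average.

Such a code comes from a second-moment argument (`exists_covering_code`). Suppose the marginals
satisfy `Θₓ Θₓ† ≤ 2^l qₓ σ`. Give `x` about `qₓ S κ` equally weighted cells, and shift each row of
the table cyclically; averaging over shifts shows that some choice makes the fluctuations of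
different rows add up without positive cross terms. Powers–Størmer and Cauchy–Schwarz turn this
variance into a squared distance `√(2^l / κ)`, which is `ε²` for `κ = 2^l / ε⁴`; this is the origin
of `4 log (1/ε)`.

Smoothing enters twice. A nearly optimal state for the max-information gives, by Uhlmann, dominated
vectors `Θ` near `Ψ` (`exists_dominated_vectors`). An operator of rank `r` near the `X_A'` marginal
gives a set `T` of at most `2r` values carrying nearly all weight (`exists_finset_of_rank`), and
only these need cells. The table then needs about `2^l / ε⁴` messages per block and about `r` cells
in total. If `r` is already small enough for the first bound, the values in `T` are sent directly
without shared randomness. -/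

namespace StateSplitting

/-! ### Hilbert–Schmidt geometry and operator order -/

section HilbertSchmidt

variable {m n k : Type*} [Fintype m] [Fintype n] [Fintype k]

/-- The real part of the Hilbert–Schmidt inner product. -/
noncomputable def hs (X Y : Matrix m n ℂ) : ℝ := (X.conjTranspose * Y).trace.re

/-- The squared Hilbert–Schmidt norm. -/
noncomputable def nsq (X : Matrix m n ℂ) : ℝ := hs X X

theorem hs_eq_sum (X Y : Matrix m n ℂ) : hs X Y = ∑ i, ∑ j, (star (X i j) * Y i j).re := by
  rw [hs, Matrix.trace, Complex.re_sum, Finset.sum_comm]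
  refine Finset.sum_congr rfl fun j _ => ?_
  simp [Matrix.mul_apply]

theorem nsq_eq_sum (X : Matrix m n ℂ) : nsq X = ∑ i, ∑ j, ‖X i j‖ ^ 2 := by
  rw [nsq, hs_eq_sum]
  refine Finset.sum_congr rfl fun i _ => Finset.sum_congr rfl fun j _ => ?_
  rw [← Complex.normSq_eq_norm_sq, Complex.normSq_apply]
  simp

theorem hs_comm (X Y : Matrix m n ℂ) : hs X Y = hs Y X := by
  simp only [hs_eq_sum]
  refine Finset.sum_congr rfl fun i _ => Finset.sum_congr rfl fun j _ => ?_
  simp; ring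

theorem hs_add_left (X Y Z : Matrix m n ℂ) : hs (X + Y) Z = hs X Z + hs Y Z := by
  simp [hs, Matrix.add_mul]

theorem hs_add_right (X Y Z : Matrix m n ℂ) : hs X (Y + Z) = hs X Y + hs X Z := by
  simp [hs, Matrix.mul_add]

theorem hs_sub_left (X Y Z : Matrix m n ℂ) : hs (X - Y) Z = hs X Z - hs Y Z := by
  simp [hs, Matrix.sub_mul]

theorem hs_sub_right (X Y Z : Matrix m n ℂ) : hs X (Y - Z) = hs X Y - hs X Z := by
  simp [hs, Matrix.mul_sub]

theorem hs_smul_left (t : ℝ) (X Y : Matrix m n ℂ) : hs (t • X) Y = t * hs X Y := by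
  simp [hs]

theorem hs_smul_right (t : ℝ) (X Y : Matrix m n ℂ) : hs X (t • Y) = t * hs X Y := by
  simp [hs]

theorem hs_sum_right {ι : Type*} (s : Finset ι) (X : Matrix m n ℂ) (Y : ι → Matrix m n ℂ) :
    hs X (∑ i ∈ s, Y i) = ∑ i ∈ s, hs X (Y i) := by
  simp [hs, Matrix.mul_sum, Matrix.trace_sum]

theorem nsq_nonneg (X : Matrix m n ℂ) : 0 ≤ nsq X := by
  rw [nsq_eq_sum]; positivity

theorem nsq_smul (t : ℝ) (X : Matrix m n ℂ) : nsq (t • X) = t ^ 2 * nsq X := by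
  rw [nsq, hs_smul_left, hs_smul_right, nsq]; ring

theorem nsq_add (X Y : Matrix m n ℂ) : nsq (X + Y) = nsq X + 2 * hs X Y + nsq Y := by
  simp only [nsq, hs_add_left, hs_add_right, hs_comm Y X]; ring

theorem nsq_sub (X Y : Matrix m n ℂ) : nsq (X - Y) = nsq X - 2 * hs X Y + nsq Y := by
  simp only [nsq, hs_sub_left, hs_sub_right, hs_comm Y X]; ring

theorem nsq_eq_trace (X : Matrix m n ℂ) : nsq X = (X * X.conjTranspose).trace.re := by
  rw [nsq, hs, Matrix.trace_mul_comm]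

theorem nsq_conjTranspose (X : Matrix m n ℂ) : nsq X.conjTranspose = nsq X := by
  rw [nsq_eq_trace, Matrix.conjTranspose_conjTranspose]; rfl

/-- The triangle inequality for a quadratic form that is nonnegative on a line. -/
theorem quadratic_triangle {a b c : ℝ} (h : ∀ t : ℝ, 0 ≤ a + 2 * t * c + t ^ 2 * b) :
    c ≤ √a * √b ∧ a + 2 * c + b ≤ (√a + √b) ^ 2 := by
  have ha : 0 ≤ a := by simpa using h 0
  have hb : 0 ≤ b := by
    -- With `b < 0`, adding the inequalities at `t` and `-t` cancels the linear term, and a large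
    -- `t` contradicts positivity.
    by_contra! hb
    have h1 := h ((a + 1) / (-b) + 1)
    have h2 := h (-((a + 1) / (-b) + 1))
    have h3 : 0 ≤ (a + 1) / (-b) := div_nonneg (by linarith) (by linarith)
    have h4 : (a + 1) / (-b) * (-b) = a + 1 := div_mul_cancel₀ _ (by linarith)
    nlinarith
  have hd : discrim b (2 * c) a ≤ 0 := discrim_le_zero fun t => by nlinarith [h t]
  have hc : c ≤ √a * √b := by
    rw [← Real.sqrt_mul ha]
    apply Real.le_sqrt_of_sq_le
    unfold discrim at hd
    nlinarith
  refine ⟨hc, ?_⟩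
  nlinarith [Real.sq_sqrt ha, Real.sq_sqrt hb]

theorem hs_le (X Y : Matrix m n ℂ) : hs X Y ≤ √(nsq X) * √(nsq Y) := by
  refine (quadratic_triangle fun t => ?_).1
  have := nsq_nonneg (X + t • Y)
  rw [nsq_add, hs_smul_right, nsq_smul] at this
  linarith

theorem hs_mul_right (X : Matrix m k ℂ) (A : Matrix k n ℂ) (Y : Matrix m n ℂ) :
    hs (X * A) Y = hs X (Y * A.conjTranspose) := by
  rw [hs, hs, Matrix.conjTranspose_mul, Matrix.mul_assoc, Matrix.trace_mul_comm, Matrix.mul_assoc]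

theorem posSemidef_trace_re_nonneg {A : Op n} (hA : A.PosSemidef) : 0 ≤ A.trace.re :=
  (Complex.nonneg_iff.1 hA.trace_nonneg).1

theorem trace_re_mono {A B : Op n} (h : A ≤ B) : A.trace.re ≤ B.trace.re := by
  have := posSemidef_trace_re_nonneg (Matrix.le_iff.1 h)
  simpa using this

theorem conj_mono {A B : Op n} (h : A ≤ B) (C : Matrix m n ℂ) :
    C * A * C.conjTranspose ≤ C * B * C.conjTranspose := by
  rw [Matrix.le_iff] at h ⊢
  simpa [Matrix.mul_sub, Matrix.sub_mul] using h.mul_mul_conjTranspose_same C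

theorem mul_conjTranspose_nonneg (C : Matrix m n ℂ) : 0 ≤ C * C.conjTranspose :=
  Matrix.nonneg_iff_posSemidef.2 (Matrix.posSemidef_self_mul_conjTranspose C)

end HilbertSchmidt

/-! ### Contractions, fidelity, Uhlmann and Powers–Størmer -/

section Contractions

variable {l m n k : Type*} [Fintype l] [Fintype m] [Fintype n] [Fintype k]
variable [DecidableEq l] [DecidableEq m] [DecidableEq n] [DecidableEq k]

/-- Contractions, as `W W† ≤ 1`. -/
def Contr (W : Matrix m n ℂ) : Prop := W * W.conjTranspose ≤ 1

theorem Contr.mul {U : Matrix l m ℂ} {V : Matrix m n ℂ} (hU : Contr U) (hV : Contr V) :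
    Contr (U * V) := by
  have := conj_mono hV U
  rw [Matrix.mul_one] at this
  refine le_trans (le_of_eq ?_) (this.trans hU)
  simp [Matrix.conjTranspose_mul, Matrix.mul_assoc]

/-- `1 - Z = (1 - Z)² + (Z - Z²)` is a sum of positive operators. -/
theorem le_one_of_mul_self_le {Z : Op n} (hZ : Z.IsHermitian) (h : Z * Z ≤ Z) : Z ≤ 1 := by
  rw [Matrix.le_iff] at h ⊢
  have h1 := Matrix.posSemidef_self_mul_conjTranspose (1 - Z)
  rw [Matrix.conjTranspose_sub, hZ.eq, Matrix.conjTranspose_one] at h1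
  have h2 := h1.add h
  rwa [show (1 - Z) * (1 - Z) + (Z - Z * Z) = 1 - Z by noncomm_ring] at h2

/-- Conjugating `W W† ≤ 1` by `W†` gives `(W† W)² ≤ W† W`. -/
theorem Contr.conjTranspose {W : Matrix m n ℂ} (hW : Contr W) : Contr W.conjTranspose := by
  rw [Contr, Matrix.conjTranspose_conjTranspose]
  apply le_one_of_mul_self_le (Matrix.isHermitian_conjTranspose_mul_self W)
  have := conj_mono hW W.conjTranspose
  simpa [Matrix.mul_assoc] using this

theorem cfc_mul_matrix (A : Op n) (f g : ℝ → ℝ) :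
    cfc f A * cfc g A = cfc (fun t => f t * g t) A :=
  (cfc_mul f g A (A.finite_real_spectrum.continuousOn f)
    (A.finite_real_spectrum.continuousOn g)).symm

theorem cfc_isHermitian (A : Op n) (f : ℝ → ℝ) : (cfc f A).IsHermitian :=
  cfc_predicate (R := ℝ) f A

/-- Douglas' factorization lemma. -/
theorem exists_contr_of_le {A : Matrix l m ℂ} {B : Matrix l n ℂ}
    (h : A * A.conjTranspose ≤ B * B.conjTranspose) : ∃ W : Matrix n m ℂ, Contr W ∧ A = B * W := by
  set H := B * B.conjTranspose with hH
  have hHs : IsSelfAdjoint H := Matrix.isHermitian_mul_conjTranspose_self B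
  -- Since `0⁻¹ = 0`, `f` is the Moore–Penrose inverse of `H`; the factor will be `B† f A`.
  set f := cfc (fun t : ℝ => t⁻¹) H with hf
  have hfH : f.conjTranspose = f := (cfc_isHermitian H _).eq
  have hid : cfc (fun t : ℝ => t) H = H := cfc_id' ℝ H
  have e1 : f * H * f = f := by
    conv_lhs => rw [← hid]
    rw [hf, cfc_mul_matrix, cfc_mul_matrix]
    congr 1; ext t
    by_cases ht : t = 0
    · simp [ht]
    · field_simp
  have e2 : H * f * H = H := by
    have : cfc (fun t : ℝ => t) H * f * cfc (fun t : ℝ => t) H = cfc (fun t : ℝ => t) H := by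
      rw [hf, cfc_mul_matrix, cfc_mul_matrix]
      congr 1; ext t
      by_cases ht : t = 0
      · simp [ht]
      · field_simp
    rwa [hid] at this
  -- The range of `A` lies in that of `H`: conjugating the hypothesis by `1 - H f` annihilates its
  -- right-hand side.
  have e3 : H * f * A = A := by
    have h1 : (A - H * f * A) * (A - H * f * A).conjTranspose ≤ 0 := by
      have h2 := conj_mono h (1 - H * f)
      have h3 : (1 - H * f) * H * (1 - H * f).conjTranspose = 0 := by
        rw [Matrix.sub_mul, e2]; simp
      rw [h3] at h2
      refine le_trans (le_of_eq ?_) h2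
      rw [show A - H * f * A = (1 - H * f) * A by rw [Matrix.sub_mul, Matrix.one_mul],
        Matrix.conjTranspose_mul]
      simp only [Matrix.mul_assoc]
    have h4 := le_antisymm h1 (mul_conjTranspose_nonneg _)
    rw [Matrix.self_mul_conjTranspose_eq_zero] at h4
    exact (sub_eq_zero.1 h4).symm
  refine ⟨B.conjTranspose * f * A, ?_, ?_⟩
  · have h1 : (B.conjTranspose * f * A) * (B.conjTranspose * f * A).conjTranspose
        ≤ B.conjTranspose * f * B := by
      have h2 := conj_mono h (B.conjTranspose * f)
      have h3 : B.conjTranspose * f * H * (B.conjTranspose * f).conjTranspose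
          = B.conjTranspose * f * B := by
        rw [Matrix.conjTranspose_mul, hfH, Matrix.conjTranspose_conjTranspose]
        calc _ = B.conjTranspose * (f * H * f) * B := by simp only [Matrix.mul_assoc]
          _ = _ := by rw [e1]
      rw [h3] at h2
      refine le_trans (le_of_eq ?_) h2
      rw [Matrix.conjTranspose_mul _ A]
      simp only [Matrix.mul_assoc]
    refine h1.trans (le_one_of_mul_self_le ?_ ?_)
    · rw [Matrix.IsHermitian, Matrix.conjTranspose_mul, Matrix.conjTranspose_mul, hfH,
        Matrix.conjTranspose_conjTranspose, Matrix.mul_assoc]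
    · refine le_of_eq ?_
      calc _ = B.conjTranspose * (f * H * f) * B := by rw [hH]; simp only [Matrix.mul_assoc]
        _ = _ := by rw [e1]
  · rw [← Matrix.mul_assoc, ← Matrix.mul_assoc, ← hH, e3]

theorem sqrt_posSemidef (A : Op n) : (CFC.sqrt A).PosSemidef :=
  Matrix.nonneg_iff_posSemidef.1 (CFC.sqrt_nonneg A)

theorem sqrt_conjTranspose (A : Op n) : (CFC.sqrt A).conjTranspose = CFC.sqrt A :=
  (sqrt_posSemidef A).1.eq

theorem sqrt_mul_sqrt {A : Op n} (hA : A.PosSemidef) : CFC.sqrt A * CFC.sqrt A = A :=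
  CFC.sqrt_mul_sqrt_self A (Matrix.nonneg_iff_posSemidef.2 hA)

theorem sqrt_mul_conjTranspose {A : Op n} (hA : A.PosSemidef) :
    CFC.sqrt A * (CFC.sqrt A).conjTranspose = A := by
  rw [sqrt_conjTranspose, sqrt_mul_sqrt hA]

theorem nsq_sqrt {A : Op n} (hA : A.PosSemidef) : nsq (CFC.sqrt A) = A.trace.re := by
  rw [nsq_eq_trace, sqrt_mul_conjTranspose hA]

theorem nsq_mul_contr_le (X : Matrix m n ℂ) {W : Matrix n k ℂ} (hW : Contr W) :
    nsq (X * W) ≤ nsq X := by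
  rw [nsq_eq_trace, nsq_eq_trace]
  apply trace_re_mono
  have := conj_mono hW X
  rw [Matrix.mul_one] at this
  refine le_trans (le_of_eq ?_) this
  simp [Matrix.conjTranspose_mul, Matrix.mul_assoc]

theorem nsq_contr_mul_le (X : Matrix n k ℂ) {W : Matrix m n ℂ} (hW : Contr W) :
    nsq (W * X) ≤ nsq X := by
  rw [← nsq_conjTranspose, Matrix.conjTranspose_mul, ← nsq_conjTranspose X]
  exact nsq_mul_contr_le _ hW.conjTranspose

/-- The trace against a contraction of a positive semidefinite operator. -/
theorem trace_contr_mul_le {Q W : Op n} (hQ : Q.PosSemidef) (hW : Contr W) :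
    (W * Q).trace.re ≤ Q.trace.re := by
  have h1 : (W * Q).trace.re = hs (CFC.sqrt Q) (W * CFC.sqrt Q) := by
    rw [hs, sqrt_conjTranspose, Matrix.trace_mul_comm (CFC.sqrt Q), Matrix.mul_assoc,
      sqrt_mul_sqrt hQ]
  rw [h1, ← nsq_sqrt hQ]
  have h2 := nsq_nonneg (CFC.sqrt Q - W * CFC.sqrt Q)
  rw [nsq_sub] at h2
  have h3 := nsq_contr_mul_le (CFC.sqrt Q) hW
  linarith

theorem trace_mul_nonneg {P Q : Op n} (hP : P.PosSemidef) (hQ : Q.PosSemidef) :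
    0 ≤ (P * Q).trace.re := by
  have h1 := posSemidef_trace_re_nonneg (hQ.mul_mul_conjTranspose_same (CFC.sqrt P))
  rwa [Matrix.trace_mul_comm, ← Matrix.mul_assoc, sqrt_conjTranspose, sqrt_mul_sqrt hP] at h1

/-- With `le_traceNorm` this is the variational formula for the trace norm. Douglas' lemma, applied
in both directions to `Γ` and `√(Γ Γ†)`, replaces the polar decomposition. -/
theorem traceNorm_exists (Γ : Op n) :
    ∃ Y : Op n, Contr Y ∧ traceNorm Γ = (Γ * Y).trace.re := by
  have hp := Matrix.posSemidef_self_mul_conjTranspose Γ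
  obtain ⟨Y, hY, h⟩ := exists_contr_of_le (A := CFC.sqrt (Γ * Γ.conjTranspose)) (B := Γ)
    (sqrt_mul_conjTranspose hp).le
  exact ⟨Y, hY, by rw [traceNorm, h]⟩

theorem le_traceNorm (Γ : Op n) {K : Op n} (hK : Contr K) :
    (K * Γ).trace.re ≤ traceNorm Γ := by
  have hp := Matrix.posSemidef_self_mul_conjTranspose Γ
  obtain ⟨Z, hZ, h⟩ := exists_contr_of_le (A := Γ) (B := CFC.sqrt (Γ * Γ.conjTranspose))
    (sqrt_mul_conjTranspose hp).ge
  have h1 : (K * Γ).trace = (Z * K * CFC.sqrt (Γ * Γ.conjTranspose)).trace := by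
    conv_lhs => rw [h]
    rw [← Matrix.mul_assoc, Matrix.trace_mul_comm, Matrix.mul_assoc]
  rw [h1]
  exact trace_contr_mul_le (sqrt_posSemidef _) (hZ.mul hK)

theorem traceNorm_nonneg (Γ : Op n) : 0 ≤ traceNorm Γ :=
  posSemidef_trace_re_nonneg (sqrt_posSemidef _)

/-- The overlap of vectors whose partial traces are dominated by `ω` and `τ` is at most the
fidelity. -/
theorem hs_le_fidelity {ω τ : Op n} (hω : ω.PosSemidef) (hτ : τ.PosSemidef)
    {U V : Matrix n k ℂ} (hU : U * U.conjTranspose ≤ ω) (hV : V * V.conjTranspose ≤ τ) :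
    hs U V ≤ fidelity ω τ := by
  obtain ⟨Y, hY, rfl⟩ := exists_contr_of_le (A := U) (B := CFC.sqrt ω)
    (by rwa [sqrt_mul_conjTranspose hω])
  obtain ⟨Z, hZ, rfl⟩ := exists_contr_of_le (A := V) (B := CFC.sqrt τ)
    (by rwa [sqrt_mul_conjTranspose hτ])
  have : hs (CFC.sqrt ω * Y) (CFC.sqrt τ * Z)
      = ((Z * Y.conjTranspose) * (CFC.sqrt ω * CFC.sqrt τ)).trace.re := by
    rw [hs, Matrix.conjTranspose_mul, sqrt_conjTranspose]
    congr 1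
    rw [← Matrix.mul_assoc, Matrix.trace_mul_comm]
    simp only [Matrix.mul_assoc]
  rw [this]
  exact le_traceNorm _ (hZ.mul hY.conjTranspose)

/-- Uhlmann's theorem for a given purification `B` of `ρ`. -/
theorem exists_hs_eq_fidelity {ρ τ : Op n} (hρ : ρ.PosSemidef) (hτ : τ.PosSemidef)
    {B : Matrix n k ℂ} (hB : B * B.conjTranspose = ρ) :
    ∃ C : Matrix n k ℂ, C * C.conjTranspose ≤ τ ∧ hs C B = fidelity τ ρ := by
  obtain ⟨Y, hY, hBY⟩ := exists_contr_of_le (A := CFC.sqrt ρ) (B := B)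
    (by rw [sqrt_mul_conjTranspose hρ, hB])
  obtain ⟨K, hK, h⟩ := traceNorm_exists (CFC.sqrt τ * CFC.sqrt ρ)
  -- `Y` relates the given purification to `√ρ` and `K` attains the trace norm; moving both onto
  -- `√τ` makes the overlap the fidelity.
  refine ⟨CFC.sqrt τ * (Y * K).conjTranspose, ?_, ?_⟩
  · have h1 := conj_mono (hY.mul hK).conjTranspose (CFC.sqrt τ)
    rw [Matrix.mul_one, sqrt_mul_conjTranspose hτ] at h1
    refine le_trans (le_of_eq ?_) h1
    rw [Matrix.conjTranspose_mul (CFC.sqrt τ)]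
    simp only [Matrix.mul_assoc]
  · rw [fidelity, h, hs, Matrix.conjTranspose_mul, Matrix.conjTranspose_conjTranspose,
      sqrt_conjTranspose]
    congr 1
    conv_rhs => rw [hBY]
    rw [Matrix.mul_assoc, Matrix.mul_assoc, Matrix.trace_mul_comm, Matrix.mul_assoc,
      Matrix.mul_assoc, Matrix.mul_assoc, Matrix.trace_mul_comm]
    simp only [Matrix.mul_assoc]

/-- Aiming for `tr √G √H`, which may be smaller than the fidelity, makes the squared distance
between the dilated vectors exactly `nsq (√G - √H)`, the quantity controlled by Powers–Størmer. -/
theorem exists_contr_hs_eq {B : Matrix l m ℂ} {C : Matrix l n ℂ} :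
    ∃ L : Matrix m n ℂ, Contr L ∧
      hs (B * L) C = hs (CFC.sqrt (B * B.conjTranspose)) (CFC.sqrt (C * C.conjTranspose)) := by
  obtain ⟨Y, hY, h1⟩ := exists_contr_of_le (A := CFC.sqrt (B * B.conjTranspose)) (B := B)
    (sqrt_mul_conjTranspose (Matrix.posSemidef_self_mul_conjTranspose B)).le
  obtain ⟨Z, hZ, h2⟩ := exists_contr_of_le (A := CFC.sqrt (C * C.conjTranspose)) (B := C)
    (sqrt_mul_conjTranspose (Matrix.posSemidef_self_mul_conjTranspose C)).le
  refine ⟨Y * Z.conjTranspose, hY.mul hZ.conjTranspose, ?_⟩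
  rw [h1, h2, ← Matrix.mul_assoc, hs_mul_right, Matrix.conjTranspose_conjTranspose]

/-- A form of the Powers–Størmer inequality. -/
theorem exists_contr_nsq_sqrt_sub_le {G H : Op n} (hG : G.PosSemidef) (hH : H.PosSemidef) :
    ∃ P : Op n, Contr P ∧
      nsq (CFC.sqrt G - CFC.sqrt H) ≤ (P * (G - H)).trace.re := by
  set g := CFC.sqrt G with hg
  set h := CFC.sqrt H with hh
  set X := g - h with hX
  have hXs : IsSelfAdjoint X := (sqrt_posSemidef G).1.sub (sqrt_posSemidef H).1
  set P := cfc (fun t : ℝ => if 0 ≤ t then (1 : ℝ) else -1) X with hP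
  set Q := cfc (fun t : ℝ => max t 0) X with hQ
  set N := cfc (fun t : ℝ => max (-t) 0) X with hN
  have hid : cfc (fun t : ℝ => t) X = X := cfc_id' ℝ X
  have hQ0 : Q.PosSemidef := Matrix.nonneg_iff_posSemidef.1 (cfc_nonneg fun t _ => le_max_right _ _)
  have hN0 : N.PosSemidef := Matrix.nonneg_iff_posSemidef.1 (cfc_nonneg fun t _ => le_max_right _ _)
  have hadd : Q + N = cfc (fun t : ℝ => |t|) X := by
    rw [hQ, hN, ← cfc_add X _ _ (X.finite_real_spectrum.continuousOn _)
      (X.finite_real_spectrum.continuousOn _)]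
    congr 1; ext t
    rcases le_total 0 t with ht | ht <;> simp [ht, abs_of_nonneg, abs_of_nonpos]
  have hPX : P * X = Q + N := by
    have : P * X = P * cfc (fun t : ℝ => t) X := by rw [hid]
    rw [hadd, this, hP, cfc_mul_matrix]
    congr 1; ext t
    split_ifs with ht
    · rw [abs_of_nonneg ht, one_mul]
    · rw [abs_of_neg (not_le.1 ht)]; ring
  have hXP : X * P = Q + N := by
    have : X * P = cfc (fun t : ℝ => t) X * P := by rw [hid]
    rw [hadd, this, hP, cfc_mul_matrix]
    congr 1; ext t
    split_ifs with ht
    · rw [abs_of_nonneg ht, mul_one]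
    · rw [abs_of_neg (not_le.1 ht)]; ring
  have hQX : Q * X - N * X = X * X := by
    have h1 : cfc (fun t : ℝ => max t 0) X * cfc (fun t : ℝ => t) X
        - cfc (fun t : ℝ => max (-t) 0) X * cfc (fun t : ℝ => t) X
        = cfc (fun t : ℝ => t) X * cfc (fun t : ℝ => t) X := by
      rw [cfc_mul_matrix, cfc_mul_matrix, cfc_mul_matrix,
        ← cfc_sub _ _ X (X.finite_real_spectrum.continuousOn _)
        (X.finite_real_spectrum.continuousOn _)]
      congr 1; ext t
      rcases le_total 0 t with ht | ht <;> simp [ht]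
    rwa [hid] at h1
  refine ⟨P, ?_, ?_⟩
  · rw [Contr, (cfc_isHermitian X _).eq, hP, cfc_mul_matrix]
    refine le_of_eq ?_
    rw [← cfc_one ℝ X hXs]
    congr 1; ext t
    split_ifs <;> simp
  -- With `X = g - h`, the difference of squares is a symmetrized product, so its trace against the
  -- sign `P` of `X` is `tr |X| (g + h)`. Splitting `|X| = Q + N` leaves `tr X²` plus the
  -- nonnegative terms `2 tr Q h` and `2 tr N g`.
  · have hGH : (2 : ℂ) • (G - H) = X * (g + h) + (g + h) * X := by
      rw [← sqrt_mul_sqrt hG, ← sqrt_mul_sqrt hH, ← hg, ← hh, hX, two_smul]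
      noncomm_ring
    have h2 : 2 * (P * (G - H)).trace.re = 2 * ((Q + N) * (g + h)).trace.re := by
      have : (2 : ℂ) * (P * (G - H)).trace = 2 * ((Q + N) * (g + h)).trace := by
        rw [← smul_eq_mul, ← Matrix.trace_smul, ← Matrix.mul_smul, hGH, Matrix.mul_add,
          ← Matrix.mul_assoc, hPX, Matrix.trace_add, ← Matrix.mul_assoc,
          Matrix.trace_mul_comm (P * (g + h)), ← Matrix.mul_assoc, hXP]
        ring
      have := congrArg Complex.re this
      simpa using this
    have h3 : nsq X = (X * X).trace.re := by rw [nsq_eq_trace]; rw [show X.conjTranspose = X from hXs]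
    have h4 := trace_mul_nonneg hQ0 (sqrt_posSemidef H)
    have h5 := trace_mul_nonneg hN0 (sqrt_posSemidef G)
    rw [← hh] at h4
    rw [← hg] at h5
    have h6 : ((Q + N) * (g + h)).trace.re
        = (X * X).trace.re + 2 * (Q * h).trace.re + 2 * (N * g).trace.re := by
      rw [← hQX, hX]
      simp only [Matrix.mul_add, Matrix.add_mul, Matrix.mul_sub, Matrix.trace_add,
        Matrix.trace_sub, Complex.add_re, Complex.sub_re]
      ring
    rw [h3]
    linarith

/-- If two operators differ by `√σ E √σ`, then their square roots are close. -/
theorem nsq_sqrt_sub_le {G H σ E : Op n} (hG : G.PosSemidef) (hH : H.PosSemidef)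
    (hσ : IsState σ) (hE : G - H = CFC.sqrt σ * E * CFC.sqrt σ) :
    nsq (CFC.sqrt G - CFC.sqrt H) ≤ √(nsq (E * CFC.sqrt σ)) := by
  -- Cauchy–Schwarz, with one `√σ` grouped with `P` and the other with `E`; the first factor has
  -- norm at most one because `tr σ = 1`.
  obtain ⟨P, hP, h⟩ := exists_contr_nsq_sqrt_sub_le hG hH
  refine h.trans ?_
  have h1 : (P * (G - H)).trace.re
      = hs (CFC.sqrt σ * P.conjTranspose) (E * CFC.sqrt σ) := by
    rw [hE, hs, Matrix.conjTranspose_mul, Matrix.conjTranspose_conjTranspose, sqrt_conjTranspose]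
    simp only [Matrix.mul_assoc]
  rw [h1]
  refine (hs_le _ _).trans ?_
  have h2 : nsq (CFC.sqrt σ * P.conjTranspose) ≤ 1 := by
    refine (nsq_mul_contr_le _ hP.conjTranspose).trans ?_
    rw [nsq_sqrt hσ.1, hσ.2]; simp
  have h3 : √(nsq (CFC.sqrt σ * P.conjTranspose)) ≤ 1 := Real.sqrt_le_one.2 h2
  exact mul_le_of_le_one_left (Real.sqrt_nonneg _) h3

end Contractions

/-! ### Channels from Kraus operators -/

section Kraus

variable {ι m n k : Type*} [Fintype ι] [Fintype m] [Fintype n] [Fintype k]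
variable [DecidableEq ι] [DecidableEq m] [DecidableEq n] [DecidableEq k]

/-- The completely positive map with Kraus operators `K`. -/
noncomputable def krausMap (K : ι → Matrix m n ℂ) : Op n →ₗ[ℂ] Op m where
  toFun M := ∑ i, K i * M * (K i).conjTranspose
  map_add' M N := by simp [Matrix.mul_add, Matrix.add_mul, Finset.sum_add_distrib]
  map_smul' c M := by simp [Finset.smul_sum]

theorem krausMap_apply (K : ι → Matrix m n ℂ) (M : Op n) (p q : m) :
    krausMap K M p q = ∑ i, ∑ a, ∑ b, K i p a * M a b * star (K i q b) := by
  simp only [krausMap, LinearMap.coe_mk, AddHom.coe_mk, Matrix.sum_apply]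
  refine Finset.sum_congr rfl fun i _ => ?_
  simp only [Matrix.mul_apply, Finset.sum_mul, Matrix.conjTranspose_apply]
  rw [Finset.sum_comm]

theorem ampliate_apply (Φ : Op n →ₗ[ℂ] Op m) (ρ : Op (n × k)) (p q : m × k) :
    ampliate Φ ρ p q = Φ (Matrix.of fun a b => ρ (a, p.2) (b, q.2)) p.1 q.1 := rfl

theorem ampliate_krausMap (K : ι → Matrix m n ℂ) (ρ : Op (n × k)) :
    ampliate (krausMap K) ρ
      = ∑ i, (K i ⊗ₖ (1 : Op k)) * ρ * (K i ⊗ₖ (1 : Op k)).conjTranspose := by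
  ext p q
  simp only [ampliate_apply, krausMap_apply, Matrix.sum_apply, Matrix.of_apply]
  refine Finset.sum_congr rfl fun i _ => ?_
  simp only [Matrix.mul_apply, Finset.sum_mul, Matrix.conjTranspose_apply,
    Matrix.kroneckerMap_apply, Fintype.sum_prod_type, Matrix.one_apply]
  rw [Finset.sum_comm]
  simp [apply_ite (starRingEnd ℂ)]

theorem krausMap_isChannel {K : ι → Matrix m n ℂ}
    (hK : ∑ i, (K i).conjTranspose * K i = 1) : IsChannel (krausMap K) := by
  refine ⟨fun d ρ hρ => ?_, fun M => ?_⟩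
  · rw [ampliate_krausMap]
    exact Matrix.posSemidef_sum _ fun i _ => hρ.mul_mul_conjTranspose_same _
  · calc (krausMap K M).trace = ∑ i, (K i * M * (K i).conjTranspose).trace := by
          simp [krausMap, Matrix.trace_sum]
      _ = ∑ i, ((K i).conjTranspose * K i * M).trace := by
          refine Finset.sum_congr rfl fun i _ => ?_
          rw [Matrix.trace_mul_comm, Matrix.mul_assoc]
      _ = M.trace := by
          rw [← Matrix.trace_sum, ← Matrix.sum_mul, hK, Matrix.one_mul]

/-- The classical channel given by a function. -/
noncomputable def classicalMap (g : n → m) : Op n →ₗ[ℂ] Op m :=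
  krausMap fun i : n => Matrix.single (g i) i (1 : ℂ)

theorem classicalMap_isChannel (g : n → m) : IsChannel (classicalMap g) := by
  apply krausMap_isChannel
  ext a b
  simp only [Matrix.conjTranspose_single, star_one, Matrix.single_mul_single_same, mul_one,
    Matrix.sum_apply, Matrix.single_apply, Matrix.one_apply]
  by_cases h : a = b
  · simp [h]
  · rw [if_neg h]
    exact Finset.sum_eq_zero fun i _ => if_neg fun h' => h (h'.1.symm.trans h'.2)

theorem classicalMap_apply (g : n → m) (M : Op n) (p q : m) :
    classicalMap g M p q = ∑ i, if g i = p ∧ g i = q then M i i else 0 := by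
  rw [classicalMap, krausMap_apply]
  refine Finset.sum_congr rfl fun i _ => ?_
  rw [Finset.sum_eq_single i, Finset.sum_eq_single i]
  · by_cases h1 : g i = p <;> by_cases h2 : g i = q <;>
      simp [Matrix.single_apply, h1, h2]
  · intro b _ hb
    simp [hb.symm]
  · simp
  · intro a _ ha
    simp [ha.symm]
  · simp

/-- A contraction is a Kraus operator of a channel. -/
theorem exists_kraus_completion (W : Matrix m n ℂ) (hW : Contr W) [Nonempty m] :
    ∃ N : Option n → Matrix m n ℂ, N none = W ∧ ∑ o, (N o).conjTranspose * N o = 1 := by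
  classical
  obtain ⟨j⟩ := ‹Nonempty m›
  have hp : (1 - W.conjTranspose * W).PosSemidef := by
    have := hW.conjTranspose
    rwa [Contr, Matrix.conjTranspose_conjTranspose, Matrix.le_iff] at this
  set D := CFC.sqrt (1 - W.conjTranspose * W) with hD
  have hDD : D.conjTranspose * D = 1 - W.conjTranspose * W := by
    rw [hD, sqrt_conjTranspose, sqrt_mul_sqrt hp]
  -- The missing part `1 - W† W = D† D` is supplied by the operators `|j⟩⟨i| D`, which reset the
  -- output to a fixed basis state.
  refine ⟨fun o => o.elim W fun i => Matrix.of fun j' i' => if j' = j then D i i' else 0, rfl, ?_⟩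
  rw [Fintype.sum_option]
  have : ∑ i : n, (Matrix.of fun j' i' => if j' = j then D i i' else 0).conjTranspose *
      (Matrix.of fun j' i' => if j' = j then D i i' else 0 : Matrix m n ℂ)
      = D.conjTranspose * D := by
    ext a b
    simp [Matrix.sum_apply, Matrix.mul_apply]
  simp only [Option.elim]
  rw [this, hDD]
  abel

end Kraus

/-! ### Protocols from codes and their fidelity -/

section Protocols

variable {A X R : Type*} [Fintype A] [DecidableEq A] [Fintype X] [DecidableEq X]
    [Fintype R] [DecidableEq R] {c S : ℕ}

/-- The vector `∑ₓ |x x⟩ ⊗ Ψₓ` as an operator from Alice's systems to `R`. -/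
noncomputable def sourceMat (Ψ : X → Matrix R A ℂ) : Matrix R (A × X × X) ℂ :=
  Matrix.of fun r i => if i.2.1 = i.2.2 then Ψ i.2.1 r i.1 else 0

/-- The vector `∑ₖ √w_k |k⟩ ⊗ |g k⟩ ⊗ Ψ_{g k}` as an operator to `R`. -/
noncomputable def blockMat (Ψ : X → Matrix R A ℂ) (g : Bits c → X) (w : Bits c → ℝ) :
    Matrix R (A × X × Bits c) ℂ :=
  Matrix.of fun r i => if i.2.1 = g i.2.2 then (√(w i.2.2) : ℂ) * Ψ i.2.1 r i.1 else 0

/-- The vector `∑ₓ |x x⟩ ⊗ Ψₓ`. -/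
noncomputable def sourceVec (Ψ : X → Matrix R A ℂ) : A × X × X × R → ℂ :=
  fun i => sourceMat Ψ i.2.2.2 (i.1, i.2.1, i.2.2.1)

theorem sum_assoc {I₁ I₂ I₃ I₄ : Type*} [Fintype I₁] [Fintype I₂] [Fintype I₃] [Fintype I₄]
    (F : I₁ × I₂ × I₃ × I₄ → ℂ) :
    ∑ p, F p = ∑ i : I₁ × I₂ × I₃, ∑ b, F (i.1, i.2.1, i.2.2, b) := by
  simp [Fintype.sum_prod_type]

theorem dephase_apply {n k : Type*} [DecidableEq k] (f : n → k) (ρ : Op n) (i j : n) :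
    dephase f ρ i j = if f i = f j then ρ i j else 0 := rfl

/-- The protocol in which Alice applies the Kraus operators `N b`, depending on her share `b`, and
Bob outputs `g (k, b)`. -/
noncomputable def codeProtocol {ι : Type*} [Fintype ι] [DecidableEq ι]
    (N : Fin S → ι → Matrix (A × X × Bits c) (A × X × X) ℂ)
    (hN : ∀ b, ∑ o, (N b o).conjTranspose * N b o = 1) (g : Bits c × Fin S → X) :
    Protocol A X c S where
  alice := krausMap fun (q : Fin S × ι) => Matrix.of fun j (i : A × X × X × Fin S) =>
    if i.2.2.2 = q.1 then N q.1 q.2 j (i.1, i.2.1, i.2.2.1) else 0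
  alice_isChannel := by
    apply krausMap_isChannel
    ext ⟨a, x, x', b⟩ ⟨a', y, y', b'⟩
    have h := congrFun (congrFun (hN b) (a, x, x')) (a', y, y')
    simp only [Matrix.sum_apply, Matrix.mul_apply, Matrix.conjTranspose_apply,
      Matrix.one_apply] at h
    simp only [Matrix.sum_apply, Matrix.mul_apply, Matrix.conjTranspose_apply, Matrix.of_apply]
    rw [Fintype.sum_prod_type, Finset.sum_eq_single b]
    · by_cases hb : b' = b
      · subst hb
        simp only [if_true, h, Matrix.one_apply, Prod.mk.injEq, and_true]
      · simp [hb, Ne.symm hb]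
    · intro b₂ _ hb₂
      simp [Ne.symm hb₂]
    · simp
  bob := classicalMap g
  bob_isChannel := classicalMap_isChannel g

/-- The vectors whose projectors sum up to the output of `codeProtocol`. -/
noncomputable def outputMat {ι : Type*}
    (N : Fin S → ι → Matrix (A × X × Bits c) (A × X × X) ℂ) (g : Bits c × Fin S → X)
    (Ψ : X → Matrix R A ℂ) : Matrix (A × X × X × R) ((Bits c × Fin S) × ι) ℂ :=
  Matrix.of fun i q => if g q.1 = i.2.2.1 then
    ((√(S : ℝ))⁻¹ : ℂ) * ∑ l, N q.1.2 q.2 (i.1, i.2.1, q.1.1) l * sourceMat Ψ i.2.2.2 l else 0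

/-- Bob's map reads only the diagonal of message and share, so the output is a sum of rank-one
terms, one for each message, shared value and Kraus index. -/
theorem codeProtocol_output {ι : Type*} [Fintype ι] [DecidableEq ι]
    (N : Fin S → ι → Matrix (A × X × Bits c) (A × X × X) ℂ)
    (hN : ∀ b, ∑ o, (N b o).conjTranspose * N b o = 1) (g : Bits c × Fin S → X)
    (Ψ : X → Matrix R A ℂ) :
    (codeProtocol N hN g).output (Matrix.vecMulVec (sourceVec Ψ) (star (sourceVec Ψ)))
      = outputMat N g Ψ * (outputMat N g Ψ).conjTranspose := by
  have hS : ((√(S : ℝ))⁻¹ : ℂ) * ((√(S : ℝ))⁻¹ : ℂ) = (S : ℂ)⁻¹ := by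
    rw [← mul_inv, ← Complex.ofReal_mul, Real.mul_self_sqrt (Nat.cast_nonneg S)]
    simp
  ext ⟨a, x, x', r⟩ ⟨a', y, y', r'⟩
  simp only [Protocol.output, codeProtocol, Matrix.submatrix_apply, ampliate_apply,
    classicalMap_apply, Protocol.afterMessage, dephase_apply, Matrix.of_apply, if_true,
    krausMap_apply, Protocol.initial]
  rw [Matrix.mul_apply, Fintype.sum_prod_type, Fintype.sum_prod_type, Fintype.sum_prod_type]
  refine Finset.sum_congr rfl fun k _ => Finset.sum_congr rfl fun b _ => ?_
  simp only [outputMat, Matrix.of_apply, Matrix.conjTranspose_apply]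
  by_cases h1 : g (k, b) = x'
  swap
  · simp [h1]
  by_cases h2 : g (k, b) = y'
  swap
  · simp [h2]
  simp only [if_pos (And.intro h1 h2), if_pos h1, if_pos h2]
  rw [Fintype.sum_prod_type, Finset.sum_eq_single b]
  · refine Finset.sum_congr rfl fun o _ => ?_
    simp only [sum_assoc, Matrix.kroneckerMap_apply, sharedRandomness, Matrix.diagonal_apply,
      ite_mul, zero_mul, Finset.sum_ite_irrel, Finset.sum_ite_eq', Finset.sum_const_zero,
      apply_ite (star : ℂ → ℂ), star_zero, mul_ite, mul_zero, Finset.mem_univ, if_true,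
      Prod.mk.injEq, and_true, star_mul', star_sum, star_inv₀]
    rw [Complex.star_def, Complex.conj_ofReal, mul_mul_mul_comm, hS, Finset.sum_mul_sum,
      Finset.mul_sum]
    refine Finset.sum_congr rfl fun i _ => ?_
    rw [Finset.mul_sum]
    refine Finset.sum_congr rfl fun j _ => ?_
    simp only [Matrix.vecMulVec_apply, sourceVec, Pi.star_apply, Complex.star_def]
    ring
  · intro b' _ hb
    refine Finset.sum_eq_zero fun o _ => ?_
    simp only [sum_assoc, Matrix.kroneckerMap_apply, sharedRandomness, Matrix.diagonal_apply]
    simp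
    exact fun h => absurd h.symm hb
  · simp

/-- The diagonal blocks of the source state, weighted by `u`, as a Gram matrix. -/
noncomputable def weightedMat (Ψ : X → Matrix R A ℂ) (u : X → ℝ) : Matrix (A × X × X × R) X ℂ :=
  Matrix.of fun i y => if i.2.2.1 = y then (√(u y) : ℂ) * sourceVec Ψ i else 0

theorem weightedMat_mul_conjTranspose (Ψ : X → Matrix R A ℂ) {u : X → ℝ} (hu : ∀ x, 0 ≤ u x)
    (i j : A × X × X × R) :
    (weightedMat Ψ u * (weightedMat Ψ u).conjTranspose) i j
      = if i.2.2.1 = j.2.2.1 then (u i.2.2.1 : ℂ) * (sourceVec Ψ i * star (sourceVec Ψ j))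
        else 0 := by
  rw [Matrix.mul_apply, Finset.sum_eq_single i.2.2.1]
  · simp only [weightedMat, Matrix.of_apply, Matrix.conjTranspose_apply, if_true]
    by_cases h : i.2.2.1 = j.2.2.1
    · rw [if_pos h.symm, if_pos h]
      have : (√(u i.2.2.1) : ℂ) * (√(u i.2.2.1) : ℂ) = (u i.2.2.1 : ℂ) := by
        rw [← Complex.ofReal_mul, Real.mul_self_sqrt (hu _)]
      rw [star_mul', Complex.star_def, Complex.conj_ofReal, mul_mul_mul_comm, this]
    · rw [if_neg (Ne.symm h), if_neg h]; simp
  · intro y _ hy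
    simp [weightedMat, hy.symm]
  · simp

/-- A code gives a protocol, whose fidelity is bounded below by the overlap of the vectors that
Alice's operations produce with the ideal ones. -/
theorem exists_protocol_fidelity (Ψ : X → Matrix R A ℂ) (hS : 0 < S)
    [Nonempty (A × X × Bits c)] (g : Bits c × Fin S → X) (w : Bits c × Fin S → ℝ)
    (hw : ∀ q, 0 ≤ w q) (hw1 : ∀ x, ∑ q, (if g q = x then w q else 0) ≤ 1)
    (L : Fin S → Matrix (A × X × X) (A × X × Bits c) ℂ) (hL : ∀ b, Contr (L b)) :
    ∃ P : Protocol A X c S,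
      (S : ℝ)⁻¹ * ∑ b, hs (sourceMat Ψ * L b)
          (blockMat Ψ (fun k => g (k, b)) fun k => S * w (k, b))
        ≤ fidelity (P.output (Matrix.vecMulVec (sourceVec Ψ) (star (sourceVec Ψ))))
          (dephase (fun (_, _, x', _) => x')
            (Matrix.vecMulVec (sourceVec Ψ) (star (sourceVec Ψ)))) := by
  -- Vectors are stored as operators into `R`, so an operation of Alice multiplies from the right by
  -- its transpose.
  have hLT : ∀ b, Contr (L b).transpose := fun b => by
    have h := Matrix.le_iff.1 (hL b).conjTranspose
    rw [Contr, Matrix.le_iff]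
    have h2 := h.transpose
    rw [Matrix.transpose_sub, Matrix.transpose_one, Matrix.transpose_mul,
      Matrix.conjTranspose_conjTranspose] at h2
    exact h2
  choose N hN0 hN using fun b => exists_kraus_completion _ (hLT b)
  refine ⟨codeProtocol N hN g, ?_⟩
  set target := dephase (fun (i : A × X × X × R) => i.2.2.1)
            (Matrix.vecMulVec (sourceVec Ψ) (star (sourceVec Ψ))) with htarget
  have ht1 : target = weightedMat Ψ 1 * (weightedMat Ψ 1).conjTranspose := by
    ext i j
    rw [weightedMat_mul_conjTranspose Ψ (by simp)]
    simp [htarget, dephase_apply, Matrix.vecMulVec_apply]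
  have ht : target.PosSemidef := by
    rw [ht1]; exact Matrix.posSemidef_self_mul_conjTranspose _
  -- Ideal vectors: cell `q` carries `√(w q)` times the block of the source at `g q`. Only the
  -- branch `none`, where the intended contraction acts, contributes to the overlap.
  set V : Matrix (A × X × X × R) ((Bits c × Fin S) × Option (A × X × X)) ℂ :=
    Matrix.of fun i q => if q.2 = none ∧ i.2.2.1 = g q.1 then
      (√(w q.1) : ℂ) * sourceVec Ψ i else 0 with hV
  have hVt : V * V.conjTranspose ≤ target := by
    set u : X → ℝ := fun x => ∑ q, (if g q = x then w q else 0) with hu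
    -- The defect is again a Gram matrix, since the weights of the cells of each `x` sum to at most
    -- one.
    have e : target - V * V.conjTranspose = weightedMat Ψ (fun x => 1 - u x) *
        (weightedMat Ψ (fun x => 1 - u x)).conjTranspose := by
      ext i j
      rw [weightedMat_mul_conjTranspose Ψ (fun x => sub_nonneg.2 (hw1 x)), Matrix.sub_apply]
      have e1 : (V * V.conjTranspose) i j = if i.2.2.1 = j.2.2.1 then
          (u i.2.2.1 : ℂ) * (sourceVec Ψ i * star (sourceVec Ψ j)) else 0 := by
        rw [Matrix.mul_apply, Fintype.sum_prod_type]
        simp only [Fintype.sum_option, hV, Matrix.of_apply, Matrix.conjTranspose_apply, hu]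
        by_cases hij : i.2.2.1 = j.2.2.1
        · simp only [if_pos hij]
          rw [Complex.ofReal_sum, Finset.sum_mul]
          refine Finset.sum_congr rfl fun q _ => ?_
          by_cases hq : i.2.2.1 = g q
          · have : (√(w q) : ℂ) * (√(w q) : ℂ) = (w q : ℂ) := by
              rw [← Complex.ofReal_mul, Real.mul_self_sqrt (hw _)]
            simp only [← hij, ← hq, and_self, if_true, reduceCtorEq, false_and, if_false, star_zero,
              mul_zero, Finset.sum_const_zero, add_zero, star_mul', Complex.star_def,
              Complex.conj_ofReal]
            rw [mul_mul_mul_comm, this]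
          · simp [← hij, hq, Ne.symm hq]
        · rw [if_neg hij]
          refine Finset.sum_eq_zero fun q _ => ?_
          by_cases hq : i.2.2.1 = g q
          · have : j.2.2.1 ≠ g q := fun h => hij (hq.trans h.symm)
            simp [this]
          · simp [hq]
      rw [e1, htarget, dephase_apply]
      split_ifs
      · simp only [Matrix.vecMulVec_apply, Pi.star_apply, Complex.ofReal_sub, Complex.ofReal_one]
        ring
      · simp
    rw [Matrix.le_iff, e]
    exact Matrix.posSemidef_self_mul_conjTranspose _
  rw [codeProtocol_output]
  refine le_trans (le_of_eq ?_) (hs_le_fidelity (Matrix.posSemidef_self_mul_conjTranspose _) ht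
    le_rfl hVt)
  have e1 : hs (outputMat N g Ψ) V = ∑ b, ∑ k, ∑ a, ∑ r, (√(S : ℝ))⁻¹ *
      (star ((sourceMat Ψ * L b) r (a, g (k, b), k)) *
        ((√(w (k, b)) : ℂ) * Ψ (g (k, b)) r a)).re := by
    rw [hs_eq_sum, Finset.sum_comm, Fintype.sum_prod_type, Fintype.sum_prod_type_right]
    refine Finset.sum_congr rfl fun b _ => Finset.sum_congr rfl fun k _ => ?_
    have h0 : ∑ o, ∑ i, (star (outputMat N g Ψ i ((k, b), some o)) * V i ((k, b), some o)).re
        = 0 := Finset.sum_eq_zero fun o _ => Finset.sum_eq_zero fun i _ => by simp [hV]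
    rw [Fintype.sum_option, h0, add_zero, Fintype.sum_prod_type]
    refine Finset.sum_congr rfl fun a _ => ?_
    rw [Fintype.sum_prod_type, Finset.sum_eq_single (g (k, b)), Fintype.sum_prod_type,
      Finset.sum_eq_single (g (k, b))]
    · refine Finset.sum_congr rfl fun r _ => ?_
      have h1 : ∑ l, N b none (a, g (k, b), k) l * sourceMat Ψ r l
          = (sourceMat Ψ * L b) r (a, g (k, b), k) := by
        rw [Matrix.mul_apply]
        exact Finset.sum_congr rfl fun l _ => by rw [hN0, Matrix.transpose_apply, mul_comm]
      have h2 : sourceMat Ψ r (a, g (k, b), g (k, b)) = Ψ (g (k, b)) r a := by simp [sourceMat]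
      simp only [outputMat, hV, Matrix.of_apply, if_true, and_self, h1, sourceVec, h2]
      rw [star_mul', star_inv₀, Complex.star_def, Complex.conj_ofReal, mul_assoc,
        ← Complex.ofReal_inv, Complex.re_ofReal_mul]
    · intro x' _ hx'
      exact Finset.sum_eq_zero fun r _ => by simp [hV, hx']
    · simp
    · intro x _ hx
      refine Finset.sum_eq_zero fun y _ => ?_
      by_cases hy : y.1 = g (k, b)
      · have : x ≠ y.1 := fun h => hx (h.trans hy)
        simp [hV, sourceVec, sourceMat, this]
      · simp [hV, hy]
    · simp
  have e2 : ∀ b, hs (sourceMat Ψ * L b) (blockMat Ψ (fun k => g (k, b)) fun k => S * w (k, b))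
      = ∑ k, ∑ a, ∑ r, √(S : ℝ) * (star ((sourceMat Ψ * L b) r (a, g (k, b), k)) *
        ((√(w (k, b)) : ℂ) * Ψ (g (k, b)) r a)).re := by
    intro b
    rw [hs_eq_sum, Finset.sum_comm]
    simp only [Fintype.sum_prod_type, blockMat, Matrix.of_apply]
    rw [Finset.sum_comm (γ := Bits c)]
    refine Finset.sum_congr rfl fun a _ => ?_
    rw [Finset.sum_comm]
    refine Finset.sum_congr rfl fun k _ => ?_
    rw [Finset.sum_eq_single (g (k, b))]
    · refine Finset.sum_congr rfl fun r _ => ?_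
      rw [if_pos rfl, Real.sqrt_mul (Nat.cast_nonneg S), Complex.ofReal_mul, mul_assoc,
        mul_left_comm, Complex.re_ofReal_mul]
    · intro x _ hx
      exact Finset.sum_eq_zero fun r _ => by simp [hx]
    · simp
  have h0 : (S : ℝ)⁻¹ * √(S : ℝ) = (√(S : ℝ))⁻¹ := by
    have : 0 < (S : ℝ) := Nat.cast_pos.2 hS
    have h1 := Real.sqrt_pos.2 this
    have h2 := Real.mul_self_sqrt this.le
    field_simp
    linarith
  rw [e1, Finset.mul_sum]
  refine Finset.sum_congr rfl fun b _ => ?_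
  rw [e2, ← h0]
  simp only [Finset.mul_sum, mul_assoc]

end Protocols

/-! ### A quadratic form for the distance to a dilated vector -/

section Dilation

variable {l m n : Type*} [Fintype l] [Fintype m] [Fintype n]
variable [DecidableEq l] [DecidableEq m] [DecidableEq n]

/-- The squared distance between `Z` and the image of `Y` under an isometric dilation of `L`. -/
noncomputable def dilationDist (L : Matrix m n ℂ) (Y : Matrix l m ℂ) (Z : Matrix l n ℂ) : ℝ :=
  nsq Y + nsq Z - 2 * hs (Y * L) Z

theorem dilationDist_nonneg {L : Matrix m n ℂ} (hL : Contr L) (Y : Matrix l m ℂ)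
    (Z : Matrix l n ℂ) : 0 ≤ dilationDist L Y Z := by
  have h1 := nsq_mul_contr_le Y hL
  have h2 := nsq_nonneg (Y * L - Z)
  rw [nsq_sub] at h2
  unfold dilationDist
  linarith

theorem dilationDist_le {L : Matrix m n ℂ} (hL : Contr L) (Y : Matrix l m ℂ)
    (Z : Matrix l n ℂ) : dilationDist L Y Z ≤ 2 * (nsq Y + nsq Z) := by
  have h1 := nsq_mul_contr_le Y hL
  have h2 := nsq_nonneg (Y * L + Z)
  rw [nsq_add] at h2
  unfold dilationDist
  linarith

/-- `dilationDist L` is a quadratic form in the pair `(Y, Z)`; together with nonnegativity this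
yields a triangle inequality without constructing a dilation. -/
theorem dilationDist_add_smul (L : Matrix m n ℂ) (Y Y' : Matrix l m ℂ) (Z Z' : Matrix l n ℂ)
    (t : ℝ) : dilationDist L (Y + t • Y') (Z + t • Z') = dilationDist L Y Z
      + 2 * t * (hs Y Y' + hs Z Z' - hs (Y * L) Z' - hs (Y' * L) Z)
      + t ^ 2 * dilationDist L Y' Z' := by
  simp only [dilationDist, nsq_add, nsq_smul, hs_smul_right, Matrix.add_mul, Matrix.smul_mul,
    hs_add_left, hs_add_right, hs_smul_left]
  ring

end Dilation

/-! ### From covering to the error of the protocol -/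

section ErrorBound

variable {A X R : Type*} [Fintype A] [DecidableEq A] [Fintype X] [DecidableEq X]
    [Fintype R] [DecidableEq R] {c S : ℕ}

theorem sourceMat_add_smul (Θ Δ : X → Matrix R A ℂ) (t : ℝ) :
    sourceMat (Θ + t • Δ) = sourceMat Θ + t • sourceMat Δ := by
  ext r i
  simp only [sourceMat, Matrix.of_apply, Matrix.add_apply, Matrix.smul_apply, Pi.add_apply,
    Pi.smul_apply]
  split_ifs <;> simp

theorem blockMat_add_smul (Θ Δ : X → Matrix R A ℂ) (g : Bits c → X) (w : Bits c → ℝ) (t : ℝ) :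
    blockMat (Θ + t • Δ) g w = blockMat Θ g w + t • blockMat Δ g w := by
  ext r i
  simp only [blockMat, Matrix.of_apply, Matrix.add_apply, Matrix.smul_apply, Pi.add_apply,
    Pi.smul_apply]
  split_ifs
  · simp; ring
  · simp

theorem sourceMat_gram (Y : X → Matrix R A ℂ) :
    sourceMat Y * (sourceMat Y).conjTranspose = ∑ x, Y x * (Y x).conjTranspose := by
  ext r r'
  simp only [Matrix.mul_apply, Matrix.sum_apply, sourceMat, Matrix.of_apply,
    Matrix.conjTranspose_apply, Fintype.sum_prod_type]
  rw [Finset.sum_comm]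
  refine Finset.sum_congr rfl fun x _ => Finset.sum_congr rfl fun a _ => ?_
  rw [Finset.sum_eq_single x]
  · simp
  · intro y _ hy
    simp [hy.symm]
  · simp

theorem blockMat_gram (Y : X → Matrix R A ℂ) (g : Bits c → X) {w : Bits c → ℝ}
    (hw : ∀ k, 0 ≤ w k) : blockMat Y g w * (blockMat Y g w).conjTranspose
      = ∑ k, w k • (Y (g k) * (Y (g k)).conjTranspose) := by
  ext r r'
  simp only [Matrix.mul_apply, Matrix.sum_apply, blockMat, Matrix.of_apply,
    Matrix.conjTranspose_apply, Fintype.sum_prod_type, Matrix.smul_apply]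
  rw [Finset.sum_congr rfl (fun a _ => Finset.sum_comm), Finset.sum_comm]
  refine Finset.sum_congr rfl fun k _ => ?_
  rw [Finset.smul_sum]
  refine Finset.sum_congr rfl fun a _ => ?_
  have h : (√(w k) : ℂ) * (√(w k) : ℂ) = (w k : ℂ) := by
    rw [← Complex.ofReal_mul, Real.mul_self_sqrt (hw k)]
  rw [Finset.sum_eq_single (g k)]
  · rw [if_pos rfl, if_pos rfl, star_mul', Complex.star_def, Complex.conj_ofReal,
      mul_mul_mul_comm, h, Complex.real_smul]
  · intro x _ hx
    simp [hx]
  · simp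

theorem nsq_sourceMat (Y : X → Matrix R A ℂ) : nsq (sourceMat Y) = ∑ x, nsq (Y x) := by
  rw [nsq_eq_trace, sourceMat_gram, Matrix.trace_sum, Complex.re_sum]
  simp only [nsq_eq_trace]

theorem nsq_blockMat (Y : X → Matrix R A ℂ) (g : Bits c → X) {w : Bits c → ℝ}
    (hw : ∀ k, 0 ≤ w k) : nsq (blockMat Y g w) = ∑ k, w k * nsq (Y (g k)) := by
  rw [nsq_eq_trace, blockMat_gram _ _ hw, Matrix.trace_sum, Complex.re_sum]
  simp only [nsq_eq_trace, Matrix.trace_smul, Complex.real_smul, Complex.re_ofReal_mul]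

theorem sum_fiber {Q : Type*} [Fintype Q] (g : Q → X) (w : Q → ℝ) (F : X → ℝ) :
    ∑ q, w q * F (g q) = ∑ x, (∑ q, if g q = x then w q else 0) * F x := by
  simp only [Finset.sum_mul]
  rw [Finset.sum_comm]
  simp

/-- For the generalized fidelity `G ≥ F`, `(1 - G)² ≥ 0` gives `1 - G² ≤ 2 - 2 G ≤ 2 - 2 F`. -/
theorem purifiedDistance_le_of_le_fidelity {n : Type*} [Fintype n] [DecidableEq n] {ω τ : Op n}
    {F δ : ℝ} (hF : F ≤ fidelity ω τ) (hδ : 0 ≤ δ) (h : 2 - 2 * F ≤ δ ^ 2) :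
    purifiedDistance ω τ ≤ δ := by
  rw [purifiedDistance, Real.sqrt_le_left hδ]
  have : F ≤ genFidelity ω τ :=
    hF.trans (le_add_of_nonneg_right (Real.sqrt_nonneg _))
  nlinarith [sq_nonneg (1 - genFidelity ω τ)]

/-- A code that covers `Θ` in every block gives a protocol for a source `Ψ` close to `Θ`. -/
theorem exists_protocol_purifiedDistance_le {Ψ Θ : X → Matrix R A ℂ} (hS : 0 < S)
    [Nonempty (A × X × Bits c)] {g : Bits c × Fin S → X} {w : Bits c × Fin S → ℝ}
    {T : Finset X} {ε ε' : ℝ} (hε : 0 ≤ ε) (hε' : 0 ≤ ε')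
    (hw : ∀ q, 0 ≤ w q)
    (hwT : ∀ x, ∑ q, (if g q = x then w q else 0) = if x ∈ T then 1 else 0)
    (hΘT : ∀ x, x ∉ T → Θ x = 0) (hΨ : ∑ x, nsq (Ψ x) = 1)
    (hT : 1 - ∑ x ∈ T, nsq (Ψ x) ≤ 2 * ε' ^ 2)
    (hd : ∑ x ∈ T, nsq (Ψ x - Θ x) ≤ 2 * ε' ^ 2)
    (hcov : (S : ℝ)⁻¹ * ∑ b, nsq (CFC.sqrt (∑ x, Θ x * (Θ x).conjTranspose) -
      CFC.sqrt (∑ k, (S * w (k, b)) • (Θ (g (k, b)) * (Θ (g (k, b))).conjTranspose))) ≤ ε ^ 2) :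
    ∃ P : Protocol A X c S,
      purifiedDistance (P.output (Matrix.vecMulVec (sourceVec Ψ) (star (sourceVec Ψ))))
          (dephase (fun (_, _, x', _) => x')
            (Matrix.vecMulVec (sourceVec Ψ) (star (sourceVec Ψ)))) ≤ ε + √14 * ε' := by
  have hS0 : (0 : ℝ) < S := Nat.cast_pos.2 hS
  have hwb : ∀ b k, 0 ≤ S * w (k, b) := fun b k => mul_nonneg hS0.le (hw _)
  set blk : (X → Matrix R A ℂ) → Fin S → Matrix R (A × X × Bits c) ℂ := fun Y b =>
    blockMat Y (fun k => g (k, b)) fun k => S * w (k, b) with hblk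
  -- Alice's contractions are designed for the smoothed vectors `Θ` but applied to the true source
  -- `Ψ`.
  choose L hL hLe using fun b => exists_contr_hs_eq (B := sourceMat Θ) (C := blk Θ b)
  obtain ⟨P, hP⟩ := exists_protocol_fidelity Ψ hS g w hw
    (fun x => by rw [hwT]; split_ifs <;> norm_num) L hL
  refine ⟨P, purifiedDistance_le_of_le_fidelity hP (by positivity) ?_⟩
  have havg : ∀ Y, (S : ℝ)⁻¹ * ∑ b, nsq (blk Y b) = ∑ x ∈ T, nsq (Y x) := by
    intro Y
    have h1 : ∀ b, nsq (blk Y b) = ∑ k, S * w (k, b) * nsq (Y (g (k, b))) := fun b =>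
      nsq_blockMat Y _ (hwb b)
    simp only [h1, Finset.mul_sum]
    rw [← Fintype.sum_prod_type_right
      (f := fun q : Bits c × Fin S => (S : ℝ)⁻¹ * (S * w q * nsq (Y (g q))))]
    have h2 : ∀ q, (S : ℝ)⁻¹ * (S * w q * nsq (Y (g q))) = w q * nsq (Y (g q)) := fun q => by
      field_simp
    simp only [h2]
    rw [sum_fiber g w fun x => nsq (Y x)]
    simp [hwT]
  set Δ := Ψ - Θ with hΔ
  have hline : ∀ t : ℝ, (S : ℝ)⁻¹ * ∑ b, dilationDist (L b) (sourceMat (Θ + t • Δ))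
        (blk (Θ + t • Δ) b)
      = (S : ℝ)⁻¹ * ∑ b, dilationDist (L b) (sourceMat Θ) (blk Θ b)
        + 2 * t * ((S : ℝ)⁻¹ * ∑ b, (hs (sourceMat Θ) (sourceMat Δ) + hs (blk Θ b) (blk Δ b)
          - hs (sourceMat Θ * L b) (blk Δ b) - hs (sourceMat Δ * L b) (blk Θ b)))
        + t ^ 2 * ((S : ℝ)⁻¹ * ∑ b, dilationDist (L b) (sourceMat Δ) (blk Δ b)) := by
    intro t
    simp only [hblk, sourceMat_add_smul, blockMat_add_smul, dilationDist_add_smul,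
      Finset.sum_add_distrib, ← Finset.mul_sum]
    ring
  -- Triangle inequality for the averaged form along the line `Θ + t Δ`, evaluated at `t = 1`, where
  -- the vectors are `Ψ`.
  have htri := (quadratic_triangle fun t => by
    rw [← hline t]
    exact mul_nonneg (inv_nonneg.2 hS0.le)
      (Finset.sum_nonneg fun b _ => dilationDist_nonneg (hL b) _ _)).2
  have h1 := hline 1
  rw [one_smul, show Θ + Δ = Ψ by rw [hΔ]; abel, mul_one, one_pow, one_mul] at h1
  rw [← h1] at htri
  have ha : (S : ℝ)⁻¹ * ∑ b, dilationDist (L b) (sourceMat Θ) (blk Θ b) ≤ ε ^ 2 := by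
    refine le_trans (le_of_eq ?_) hcov
    congr 1
    refine Finset.sum_congr rfl fun b _ => ?_
    rw [← sourceMat_gram, ← blockMat_gram Θ (fun k => g (k, b)) (hwb b), nsq_sub,
      nsq_sqrt (Matrix.posSemidef_self_mul_conjTranspose _),
      nsq_sqrt (Matrix.posSemidef_self_mul_conjTranspose _), ← nsq_eq_trace, ← nsq_eq_trace,
      dilationDist, hLe]
    ring
  have hconst : ∀ y : ℝ, (S : ℝ)⁻¹ * ∑ _b : Fin S, y = y := fun y => by
    simp [hS0.ne']
  -- `Θ` vanishes off `T`, so the discarded weight of `Ψ` adds `2 ε'²` to the `2 ε'²` from inside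
  -- `T`.
  have hΔT : ∑ x, nsq (Δ x) ≤ 4 * ε' ^ 2 := by
    have e1 := Finset.sum_add_sum_compl T fun x => nsq (Δ x)
    have e2 := Finset.sum_add_sum_compl T fun x => nsq (Ψ x)
    have e3 : ∑ x ∈ Tᶜ, nsq (Δ x) = ∑ x ∈ Tᶜ, nsq (Ψ x) :=
      Finset.sum_congr rfl fun x hx => by
        rw [hΔ, Pi.sub_apply, hΘT x (Finset.mem_compl.1 hx), sub_zero]
    have e4 : ∑ x ∈ T, nsq (Δ x) ≤ 2 * ε' ^ 2 := hd
    linarith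
  -- `12 = 2 (4 + 2)`: the source part of `Δ` costs `4 ε'²`, while the blocks see only `T` and cost
  -- `2 ε'²`.
  have hb : (S : ℝ)⁻¹ * ∑ b, dilationDist (L b) (sourceMat Δ) (blk Δ b) ≤ 12 * ε' ^ 2 := by
    have e1 : (S : ℝ)⁻¹ * ∑ b, dilationDist (L b) (sourceMat Δ) (blk Δ b)
        ≤ (S : ℝ)⁻¹ * ∑ b, 2 * (nsq (sourceMat Δ) + nsq (blk Δ b)) :=
      mul_le_mul_of_nonneg_left (Finset.sum_le_sum fun b _ => dilationDist_le (hL b) _ _)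
        (inv_nonneg.2 hS0.le)
    rw [← Finset.mul_sum, Finset.sum_add_distrib, mul_left_comm, mul_add, hconst, havg,
      nsq_sourceMat] at e1
    have e4 : ∑ x ∈ T, nsq (Δ x) ≤ 2 * ε' ^ 2 := hd
    linarith
  -- Hence `2 - 2 F` is this form plus the weight of `Ψ` off `T`, at most `2 ε'²`; that turns `12`
  -- into `14`.
  have hQ : (S : ℝ)⁻¹ * ∑ b, dilationDist (L b) (sourceMat Ψ) (blk Ψ b)
      = 1 + ∑ x ∈ T, nsq (Ψ x) - 2 * ((S : ℝ)⁻¹ * ∑ b, hs (sourceMat Ψ * L b) (blk Ψ b)) := by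
    simp only [dilationDist, Finset.sum_sub_distrib, Finset.sum_add_distrib, ← Finset.mul_sum,
      mul_sub, mul_add, hconst, havg, nsq_sourceMat, hΨ]
    ring
  have hsa : √((S : ℝ)⁻¹ * ∑ b, dilationDist (L b) (sourceMat Θ) (blk Θ b)) ≤ ε :=
    (Real.sqrt_le_left hε).2 ha
  have hsb : √((S : ℝ)⁻¹ * ∑ b, dilationDist (L b) (sourceMat Δ) (blk Δ b)) ≤ √12 * ε' := by
    rw [Real.sqrt_le_left (by positivity), mul_pow, Real.sq_sqrt (by norm_num)]
    exact hb
  have h12 : √12 ≤ √14 := Real.sqrt_le_sqrt (by norm_num)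
  have hsum := pow_le_pow_left₀ (add_nonneg (Real.sqrt_nonneg _) (Real.sqrt_nonneg _))
    (add_le_add hsa hsb) 2
  have s12 : √12 ^ 2 = 12 := Real.sq_sqrt (by norm_num)
  have s14 : √14 ^ 2 = 14 := Real.sq_sqrt (by norm_num)
  have hx : ε * ε' * √12 ≤ ε * ε' * √14 := mul_le_mul_of_nonneg_left h12 (mul_nonneg hε hε')
  have e12 : (ε + √12 * ε') ^ 2 = ε ^ 2 + 2 * (ε * ε' * √12) + 12 * ε' ^ 2 := by
    rw [add_sq, mul_pow, s12]; ring
  have e14 : (ε + √14 * ε') ^ 2 = ε ^ 2 + 2 * (ε * ε' * √14) + 14 * ε' ^ 2 := by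
    rw [add_sq, mul_pow, s14]; ring
  linarith

end ErrorBound

/-! ### Covering codes by cyclic shifts -/

section Covering

variable {A X R : Type*} [Fintype A] [DecidableEq A] [Fintype X] [DecidableEq X]
    [Fintype R] [DecidableEq R] {c S : ℕ}

theorem hs_sum_left {m n ι : Type*} [Fintype m] [Fintype n] (s : Finset ι)
    (Y : ι → Matrix m n ℂ) (X : Matrix m n ℂ) : hs (∑ i ∈ s, Y i) X = ∑ i ∈ s, hs (Y i) X := by
  rw [hs_comm, hs_sum_right]
  exact Finset.sum_congr rfl fun i _ => hs_comm _ _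

/-- Cyclic shifts of centred families of vectors can be chosen such that the vectors do not add up
coherently. -/
theorem exists_shift_sum_nsq_le {m n K : Type*} [Fintype m] [Fintype n] [DecidableEq K] [NeZero S]
    (s : Finset K) (z : K → Fin S → Matrix m n ℂ) (hz : ∀ k, ∑ b, z k b = 0) :
    ∃ γ : K → Fin S, ∑ b, nsq (∑ k ∈ s, z k (b + γ k)) ≤ ∑ k ∈ s, ∑ b, nsq (z k b) := by
  induction s using Finset.induction_on with
  | empty => exact ⟨fun _ => 0, by simp [nsq, hs]⟩
  | insert k s hk ih =>
    obtain ⟨γ, hγ⟩ := ih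
    set Y : Fin S → Matrix m n ℂ := fun b => ∑ k ∈ s, z k (b + γ k) with hY
    -- The cross term averages to zero over all shifts `t` because the row `z k` is centred, so some
    -- shift makes it nonpositive.
    obtain ⟨t, -, ht⟩ : ∃ t ∈ (Finset.univ : Finset (Fin S)),
        ∑ b, hs (z k (b + t)) (Y b) ≤ 0 := by
      refine Finset.exists_le_of_sum_le Finset.univ_nonempty (le_of_eq ?_)
      rw [Finset.sum_comm, Finset.sum_const_zero]
      refine Finset.sum_eq_zero fun b _ => ?_
      rw [← hs_sum_left, show ∑ t, z k (b + t) = ∑ t, z k t from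
        Equiv.sum_comp (Equiv.addLeft b) (z k), hz]
      simp [hs]
    refine ⟨Function.update γ k t, ?_⟩
    have h1 : ∀ b, ∑ k' ∈ insert k s, z k' (b + Function.update γ k t k') = z k (b + t) + Y b := by
      intro b
      rw [Finset.sum_insert hk, Function.update_self]
      congr 1
      refine Finset.sum_congr rfl fun k' hk' => ?_
      rw [Function.update_of_ne (ne_of_mem_of_not_mem hk' hk)]
    have h2 : ∑ b, nsq (z k (b + t)) = ∑ b, nsq (z k b) :=
      Equiv.sum_comp (Equiv.addRight t) fun b => nsq (z k b)
    simp only [h1, nsq_add, Finset.sum_add_distrib, ← Finset.mul_sum, h2]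
    rw [Finset.sum_insert hk]
    linarith

/-- Fills the table with prescribed multiplicities; `none` marks the cells left empty. -/
theorem exists_fun_card_fiber {Y : Type*} [Fintype Y] [DecidableEq Y] (n : X → ℕ)
    (h : ∑ x, n x ≤ Fintype.card Y) :
    ∃ f : Y → Option X, ∀ x, (Finset.univ.filter fun y => f y = some x).card = n x := by
  classical
  obtain ⟨e⟩ : Nonempty ((Σ x, Fin (n x)) ↪ Y) :=
    Function.Embedding.nonempty_of_card_le (by simpa using h)
  refine ⟨fun y => if h : ∃ p, e p = y then some h.choose.1 else none, fun x => ?_⟩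
  have hf : ∀ p, (if h : ∃ p', e p' = e p then some h.choose.1 else none) = some p.1 := by
    intro p
    have h : ∃ p', e p' = e p := ⟨p, rfl⟩
    rw [dif_pos h, e.injective h.choose_spec]
  have : (Finset.univ.filter fun y =>
      (if h : ∃ p, e p = y then some h.choose.1 else none) = some x)
      = Finset.univ.map ⟨fun i : Fin (n x) => e ⟨x, i⟩, fun i j hij => by
        simpa using e.injective hij⟩ := by
    ext y
    simp only [Finset.mem_filter, Finset.mem_univ, true_and, Finset.mem_map]
    constructor
    · intro hy
      by_cases h : ∃ p, e p = y
      · obtain ⟨⟨x', i⟩, rfl⟩ := h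
        rw [hf] at hy
        obtain rfl : x' = x := by simpa using hy
        exact ⟨i, rfl⟩
      · rw [dif_neg h] at hy
        cases hy
    · rintro ⟨i, rfl⟩
      exact hf _
  rw [this, Finset.card_map, Finset.card_univ, Fintype.card_fin]

theorem sum_option_fiber {Y V : Type*} [Fintype Y] [AddCommMonoid V] {f : Y → Option X}
    {n : X → ℕ} (hf : ∀ x, (Finset.univ.filter fun y => f y = some x).card = n x)
    {F : Option X → V} (hF : F none = 0) : ∑ y, F (f y) = ∑ x, n x • F (some x) := by
  rw [← Finset.sum_fiberwise (s := Finset.univ) (g := f), Fintype.sum_option]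
  rw [Finset.sum_eq_zero (s := Finset.univ.filter fun y => f y = none), zero_add]
  · refine Finset.sum_congr rfl fun x _ => ?_
    rw [← hf x, ← Finset.sum_const]
    refine Finset.sum_congr rfl fun y hy => ?_
    rw [(Finset.mem_filter.1 hy).2]
  · intro y hy
    rw [(Finset.mem_filter.1 hy).2, hF]

/-- An operator dominated by a multiple of `σ` factors through `√σ`. -/
theorem exists_sqrt_factor {Θ : Matrix R A ℂ} {σ : Op R} (hσ : σ.PosSemidef) {μ : ℝ} (hμ : 0 ≤ μ)
    (h : Θ * Θ.conjTranspose ≤ μ • σ) :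
    ∃ D : Matrix R A ℂ, Θ = CFC.sqrt σ * D ∧ nsq (D * Θ.conjTranspose) ≤ μ * nsq Θ := by
  have e : μ • σ = (√μ • CFC.sqrt σ) * (√μ • CFC.sqrt σ).conjTranspose := by
    rw [Matrix.conjTranspose_smul, star_trivial, Matrix.smul_mul, Matrix.mul_smul, smul_smul,
      Real.mul_self_sqrt hμ, sqrt_mul_conjTranspose hσ]
  rw [e] at h
  obtain ⟨W, hW, hΘ⟩ := exists_contr_of_le h
  refine ⟨√μ • W, ?_, ?_⟩
  · rw [hΘ, Matrix.smul_mul, Matrix.mul_smul]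
  · rw [Matrix.smul_mul, nsq_smul, Real.sq_sqrt hμ, ← nsq_conjTranspose Θ]
    exact mul_le_mul_of_nonneg_left (nsq_contr_mul_le _ hW) hμ

/-- The variance is at most the second moment. -/
theorem sum_nsq_centre_le {m n : Type*} [Fintype m] [Fintype n] (v : Fin S → Matrix m n ℂ) :
    ∑ b, nsq ((S : ℝ) • v b - ∑ b', v b') ≤ (S : ℝ) ^ 2 * ∑ b, nsq (v b) := by
  simp only [nsq_sub, nsq_smul, hs_smul_left, Finset.sum_add_distrib, Finset.sum_sub_distrib,
    ← Finset.mul_sum]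
  rw [← hs_sum_left]
  have h1 : 0 ≤ (S : ℝ) * nsq (∑ b, v b) := mul_nonneg (Nat.cast_nonneg S) (nsq_nonneg _)
  simp only [Finset.sum_const, Finset.card_univ, Fintype.card_fin, nsmul_eq_mul]
  unfold nsq at h1 ⊢
  linarith

/-- Concavity of the square root, in the form of Cauchy–Schwarz. -/
theorem mean_sqrt_le (hS : 0 < S) {v : Fin S → ℝ} (hv : ∀ b, 0 ≤ v b) {B : ℝ}
    (h : ∑ b, v b ≤ S * B) : (S : ℝ)⁻¹ * ∑ b, √(v b) ≤ √B := by
  have hS0 : (0 : ℝ) < S := Nat.cast_pos.2 hS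
  rw [inv_mul_le_iff₀ hS0]
  have h1 := sq_sum_le_card_mul_sum_sq (s := Finset.univ) (f := fun b => √(v b))
  simp only [Real.sq_sqrt (hv _), Finset.card_univ, Fintype.card_fin] at h1
  have hB : 0 ≤ B := by
    have := (Finset.sum_nonneg fun b _ => hv b).trans h
    exact nonneg_of_mul_nonneg_right this hS0
  apply abs_le_of_sq_le_sq' _ (by positivity) |>.2
  rw [mul_pow, Real.sq_sqrt hB]
  nlinarith

/-- Existence of codes all of whose blocks cover the average operator. -/
theorem exists_covering_code {Θ : X → Matrix R A ℂ} {σ : Op R} (hσ : IsState σ) (hS : 0 < S)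
    [Nonempty X] {q : X → ℝ} {μ κ : ℝ} (hq : ∀ x, 0 ≤ q x) (hμ : 0 ≤ μ) (hκ : 0 < κ)
    (hΘ : ∀ x, Θ x * (Θ x).conjTranspose ≤ (μ * q x) • σ) (hΘ1 : ∑ x, nsq (Θ x) ≤ 1)
    {T : Finset X} (hΘT : ∀ x, x ∉ T → Θ x = 0) {n : X → ℕ} (hnT : ∀ x, 0 < n x ↔ x ∈ T)
    (hn : ∑ x, n x ≤ Fintype.card (Bits c × Fin S))
    (hnq : ∀ x ∈ T, q x * (S * κ) ≤ n x) :
    ∃ (g : Bits c × Fin S → X) (w : Bits c × Fin S → ℝ), (∀ y, 0 ≤ w y) ∧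
      (∀ x, ∑ y, (if g y = x then w y else 0) = if x ∈ T then 1 else 0) ∧
      (S : ℝ)⁻¹ * ∑ b, nsq (CFC.sqrt (∑ x, Θ x * (Θ x).conjTranspose) -
        CFC.sqrt (∑ k, (S * w (k, b)) • (Θ (g (k, b)) * (Θ (g (k, b))).conjTranspose)))
        ≤ √(μ / κ) := by
  have hS0 : (0 : ℝ) < S := Nat.cast_pos.2 hS
  have : NeZero S := ⟨hS.ne'⟩
  obtain ⟨x₀⟩ := ‹Nonempty X›
  have hD : ∀ x, ∃ D : Matrix R A ℂ, Θ x = CFC.sqrt σ * D ∧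
      nsq (D * (Θ x).conjTranspose) ≤ μ * q x * nsq (Θ x) ∧ (x ∉ T → D = 0) := by
    intro x
    by_cases hx : x ∈ T
    · obtain ⟨D, h1, h2⟩ := exists_sqrt_factor hσ.1 (mul_nonneg hμ (hq x)) (hΘ x)
      exact ⟨D, h1, h2, fun h => absurd hx h⟩
    · exact ⟨0, by simp [hΘT x hx], by simp [hΘT x hx, nsq, hs], fun _ => rfl⟩
  choose D hD1 hD2 hD3 using hD
  set E : X → Op R := fun x => D x * (D x).conjTranspose with hE
  have hΘE : ∀ x, Θ x * (Θ x).conjTranspose = CFC.sqrt σ * E x * CFC.sqrt σ := by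
    intro x
    rw [hD1, Matrix.conjTranspose_mul, sqrt_conjTranspose, hE]
    simp only [Matrix.mul_assoc]
  have hEσ : ∀ x, nsq (E x * CFC.sqrt σ) ≤ μ * q x * nsq (Θ x) := by
    intro x
    have : E x * CFC.sqrt σ = D x * (Θ x).conjTranspose := by
      rw [hD1 x, Matrix.conjTranspose_mul, sqrt_conjTranspose, Matrix.mul_assoc]
    rw [this]
    exact hD2 x
  obtain ⟨f, hf⟩ := exists_fun_card_fiber (Y := Bits c × Fin S) n hn
  set wt : Option X → ℝ := fun o => o.elim 0 fun x => (n x : ℝ)⁻¹ with hwt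
  set M : Option X → Op R := fun o => o.elim 0 fun x => (n x : ℝ)⁻¹ • E x with hM
  -- Deviation of a cell, scaled by `S`, from its row total. The row totals add up to `∑ₓ Eₓ`, so
  -- summing `z` over a column gives the error of that block.
  set z : Bits c → Fin S → Op R := fun k b =>
    (S : ℝ) • (M (f (k, b)) * CFC.sqrt σ) - ∑ b', M (f (k, b')) * CFC.sqrt σ with hz
  obtain ⟨γ, hγ⟩ := exists_shift_sum_nsq_le Finset.univ z fun k => by
    simp only [hz, Finset.sum_sub_distrib, ← Finset.smul_sum, Finset.sum_const, Finset.card_univ,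
      Fintype.card_fin, ← Nat.cast_smul_eq_nsmul ℝ, sub_self]
  have hnM : ∀ x, n x • M (some x) = E x := by
    intro x
    by_cases hx : x ∈ T
    · have : (n x : ℝ) ≠ 0 := Nat.cast_ne_zero.2 ((hnT x).2 hx).ne'
      simp only [hM, Option.elim]
      rw [← Nat.cast_smul_eq_nsmul ℝ, smul_smul, mul_inv_cancel₀ this, one_smul]
    · simp [hM, hE, hD3 x hx]
  -- The shifts permute the cells, so multiplicities and total weights are unchanged. Empty cells
  -- get the dummy label `x₀` with weight zero.
  set φ : Bits c × Fin S ≃ Bits c × Fin S :=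
    Equiv.prodShear (Equiv.refl _) fun k => Equiv.addRight (γ k) with hφ
  have hφa : ∀ k b, φ (k, b) = (k, b + γ k) := fun k b => rfl
  refine ⟨fun y => (f (φ y)).getD x₀, fun y => wt (f (φ y)), fun y => ?_, fun x => ?_, ?_⟩
  · simp only [hwt]
    cases f (φ y) <;> simp
  · rw [Equiv.sum_comp φ fun y => if (f y).getD x₀ = x then wt (f y) else 0]
    rw [sum_option_fiber hf (F := fun o => if o.getD x₀ = x then wt o else 0)
      (by simp [hwt]), Finset.sum_eq_single x]
    · by_cases hx : x ∈ T
      · have : (n x : ℝ) ≠ 0 := Nat.cast_ne_zero.2 ((hnT x).2 hx).ne'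
        simp [hwt, hx, this]
      · have : n x = 0 := Nat.eq_zero_of_not_pos fun h => hx ((hnT x).1 h)
        simp [hx, this]
    · intro y _ hy
      simp [hy]
    · simp
  · set Eb : Fin S → Op R := fun b => ∑ x, E x - (S : ℝ) • ∑ k, M (f (k, b + γ k)) with hEb
    have hzE : ∀ b, ∑ k, z k (b + γ k) = -(Eb b * CFC.sqrt σ) := by
      intro b
      have h1 : ∑ k, ∑ b', M (f (k, b')) = ∑ x, E x := by
        rw [← Fintype.sum_prod_type (f := fun y => M (f y)), sum_option_fiber hf (F := M) rfl]
        simp only [hnM]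
      simp only [hz, Finset.sum_sub_distrib, hEb, ← Finset.smul_sum, ← Finset.sum_mul,
        Matrix.sub_mul, Matrix.smul_mul, h1]
      abel
    have hsum : ∑ b, nsq (Eb b * CFC.sqrt σ) ≤ S * (μ / κ) := by
      have h1 : ∀ b, nsq (∑ k, z k (b + γ k)) = nsq (Eb b * CFC.sqrt σ) := by
        intro b
        rw [hzE]
        simp [nsq, hs]
      simp only [h1] at hγ
      refine hγ.trans ?_
      have h2 : ∑ k, ∑ b, nsq (z k b)
          ≤ (S : ℝ) ^ 2 * ∑ y, nsq (M (f y) * CFC.sqrt σ) := by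
        rw [Fintype.sum_prod_type, Finset.mul_sum]
        exact Finset.sum_le_sum fun k _ => sum_nsq_centre_le _
      refine h2.trans ?_
      rw [sum_option_fiber hf (F := fun o => nsq (M o * CFC.sqrt σ)) (by simp [hM, nsq, hs])]
      -- The `n x` cells of weight `1 / n x` contribute `nsq (Eₓ √σ) / n x`; the domination by `σ`
      -- brings in `qₓ`, which `n x ≥ qₓ S κ` cancels.
      have h3 : ∀ x, n x • nsq (M (some x) * CFC.sqrt σ) ≤ μ / (S * κ) * nsq (Θ x) := by
        intro x
        by_cases hx : x ∈ T
        · have hn0 : (0 : ℝ) < n x := Nat.cast_pos.2 ((hnT x).2 hx)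
          have e1 : n x • nsq (M (some x) * CFC.sqrt σ)
              = (n x : ℝ)⁻¹ * nsq (E x * CFC.sqrt σ) := by
            simp only [hM, Option.elim, Matrix.smul_mul, nsq_smul, nsmul_eq_mul]
            field_simp
          have hSκ : 0 < S * κ := mul_pos hS0 hκ
          rw [e1]
          calc (n x : ℝ)⁻¹ * nsq (E x * CFC.sqrt σ) ≤ (n x : ℝ)⁻¹ * (μ * q x * nsq (Θ x)) :=
                mul_le_mul_of_nonneg_left (hEσ x) (inv_nonneg.2 hn0.le)
            _ = μ * ((n x : ℝ)⁻¹ * q x) * nsq (Θ x) := by ring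
            _ ≤ μ * (S * κ)⁻¹ * nsq (Θ x) := by
                refine mul_le_mul_of_nonneg_right (mul_le_mul_of_nonneg_left ?_ hμ) (nsq_nonneg _)
                rw [inv_mul_le_iff₀ hn0, ← div_eq_mul_inv, le_div_iff₀ hSκ]
                exact hnq x hx
            _ = _ := by rw [div_eq_mul_inv]
        · simp [hM, hE, hD3 x hx, hΘT x hx, nsq, hs]
      have h4 : ∑ x, n x • nsq (M (some x) * CFC.sqrt σ) ≤ μ / (S * κ) := by
        refine (Finset.sum_le_sum fun x _ => h3 x).trans ?_
        rw [← Finset.mul_sum]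
        exact mul_le_of_le_one_right (by positivity) hΘ1
      refine (mul_le_mul_of_nonneg_left h4 (by positivity)).trans (le_of_eq ?_)
      field_simp
    refine le_trans ?_ (mean_sqrt_le hS (fun b => nsq_nonneg _) hsum)
    refine mul_le_mul_of_nonneg_left (Finset.sum_le_sum fun b _ => ?_) (inv_nonneg.2 hS0.le)
    have hterm : ∀ k, (S * wt (f (φ (k, b)))) • (Θ ((f (φ (k, b))).getD x₀) *
        (Θ ((f (φ (k, b))).getD x₀)).conjTranspose)
        = CFC.sqrt σ * ((S : ℝ) • M (f (k, b + γ k))) * CFC.sqrt σ := by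
      intro k
      rw [hφa]
      cases hfk : f (k, b + γ k) with
      | none => simp [hwt, hM]
      | some x =>
        simp only [hwt, hM, Option.elim, Option.getD_some, hΘE]
        simp only [Matrix.mul_smul, Matrix.smul_mul, smul_smul]
    refine nsq_sqrt_sub_le (Matrix.posSemidef_sum _ fun x _ =>
      Matrix.posSemidef_self_mul_conjTranspose _) (Matrix.posSemidef_sum _ fun k _ => ?_) hσ ?_
    · refine (Matrix.posSemidef_self_mul_conjTranspose _).smul (mul_nonneg hS0.le ?_)
      simp only [hwt]
      cases f (φ (k, b)) <;> simp
    · simp only [hterm]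
      simp only [hΘE]
      rw [← Finset.sum_mul, ← Finset.mul_sum, ← Finset.sum_mul, ← Finset.mul_sum, hEb,
        ← Matrix.sub_mul, ← Matrix.mul_sub, ← Finset.smul_sum]

end Covering

/-! ### Smoothing the rank -/

section Smoothing

variable {n : Type*} [Fintype n] [DecidableEq n]

/-- As `ρ` is normalized, the correction term of the generalized fidelity vanishes. -/
theorem le_fidelity_sq_of_mem_ball {ε : ℝ} (hε : 0 ≤ ε) {ρ τ : Op n} (hρ : IsState ρ)
    (hτ : τ ∈ smoothingBall ε ρ) : 1 - ε ^ 2 ≤ fidelity τ ρ ^ 2 := by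
  have h := hτ.2
  rw [purifiedDistance, genFidelity, hρ.2] at h
  simp only [Complex.one_re, sub_self, mul_zero, Real.sqrt_zero, add_zero] at h
  rw [Real.sqrt_le_left hε] at h
  linarith

theorem le_fidelity_of_mem_ball {ε : ℝ} (hε : 0 ≤ ε) {ρ τ : Op n} (hρ : IsState ρ)
    (hτ : τ ∈ smoothingBall ε ρ) : 1 - ε ^ 2 ≤ fidelity τ ρ := by
  have h1 := le_fidelity_sq_of_mem_ball hε hρ hτ
  have h2 : 0 ≤ fidelity τ ρ := traceNorm_nonneg _
  rcases le_total 1 (fidelity τ ρ) with h | h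
  · nlinarith [sq_nonneg ε]
  · nlinarith

theorem self_mem_ball {ε : ℝ} (hε : 0 ≤ ε) {ρ : Op n} (hρ : IsState ρ) :
    ρ ∈ smoothingBall ε ρ := by
  refine ⟨⟨hρ.1, by rw [hρ.2]; simp⟩, purifiedDistance_le_of_le_fidelity (F := 1) ?_ hε ?_⟩
  · have := hs_le_fidelity hρ.1 hρ.1 (sqrt_mul_conjTranspose hρ.1).le
      (sqrt_mul_conjTranspose hρ.1).le
    have h2 : nsq (CFC.sqrt ρ) = 1 := by rw [nsq_sqrt hρ.1, hρ.2]; simp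
    rwa [← nsq, h2] at this
  · nlinarith [sq_nonneg ε]

/-- The orthogonal projection onto the range of a Hermitian operator. -/
theorem exists_support_projection {τ : Op n} (hτ : τ.IsHermitian) :
    ∃ P : Op n, P.IsHermitian ∧ P * P = P ∧ P * τ = τ ∧ P.trace = τ.rank := by
  have hs : IsSelfAdjoint τ := hτ
  have hid : cfc (fun t : ℝ => t) τ = τ := cfc_id' ℝ τ
  refine ⟨cfc (fun t : ℝ => if t = 0 then 0 else 1) τ, cfc_isHermitian _ _, ?_, ?_, ?_⟩
  · rw [cfc_mul_matrix]
    congr 1; ext t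
    split_ifs <;> simp
  · have : cfc (fun t : ℝ => if t = 0 then 0 else 1) τ * cfc (fun t : ℝ => t) τ
        = cfc (fun t : ℝ => t) τ := by
      rw [cfc_mul_matrix]
      congr 1; ext t
      split_ifs with h <;> simp [h]
    rwa [hid] at this
  · rw [hτ.cfc_eq, Matrix.IsHermitian.cfc, Unitary.conjStarAlgAut_apply, Matrix.trace_mul_comm,
      ← mul_assoc, Unitary.coe_star_mul_self, one_mul, Matrix.trace_diagonal,
      hτ.rank_eq_card_non_zero_eigs, Fintype.card_subtype, Finset.card_filter]
    push_cast
    refine Finset.sum_congr rfl fun i _ => ?_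
    simp only [Function.comp_apply]
    split_ifs <;> simp_all

/-- An operator of rank `r` close to a diagonal one gives a set of about `r` points that carries
most of the weight. -/
theorem exists_finset_of_rank {p : n → ℝ} (hp : ∀ x, 0 ≤ p x)
    {τ : Op n} (hτ : IsSubState τ) {ε : ℝ} (hε1 : ε ^ 2 < 1) (hp1 : ∑ x, p x = 1)
    (hF : 1 - ε ^ 2 ≤ fidelity τ (Matrix.diagonal fun x => (p x : ℂ)) ^ 2) :
    0 < τ.rank ∧ ∃ T : Finset n, T.card ≤ 2 * τ.rank ∧ 1 - ∑ x ∈ T, p x ≤ 2 * ε ^ 2 := by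
  set ρ : Op n := Matrix.diagonal fun x => (p x : ℂ) with hρ
  have hρ0 : ρ.PosSemidef := Matrix.PosSemidef.diagonal fun x => by simpa using hp x
  obtain ⟨P, hP, hPP, hPτ, htr⟩ := exists_support_projection hτ.1.1
  have hPC : P * P.conjTranspose = P := by rw [hP.eq, hPP]
  have hP0 : P.PosSemidef := hPC ▸ Matrix.posSemidef_self_mul_conjTranspose P
  have hP1 : P ≤ 1 := le_one_of_mul_self_le hP hPP.le
  set d : n → ℝ := fun x => (P x x).re with hd
  have hd0 : ∀ x, 0 ≤ d x := fun x => (Complex.nonneg_iff.1 (hP0.diag_nonneg (i := x))).1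
  have hd1 : ∀ x, d x ≤ 1 := fun x => by
    have := (Complex.nonneg_iff.1 ((Matrix.le_iff.1 hP1).diag_nonneg (i := x))).1
    simpa [hd] using this
  have hdsum : ∑ x, d x = τ.rank := by
    have := congrArg Complex.re htr
    rwa [Matrix.trace, Complex.re_sum, Complex.natCast_re] at this
  have hPs : P * CFC.sqrt τ = CFC.sqrt τ := by
    have h1 : (CFC.sqrt τ - P * CFC.sqrt τ) * (CFC.sqrt τ - P * CFC.sqrt τ).conjTranspose = 0 := by
      rw [Matrix.conjTranspose_sub, Matrix.conjTranspose_mul, sqrt_conjTranspose, hP.eq,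
        Matrix.mul_sub, Matrix.sub_mul, Matrix.sub_mul, Matrix.mul_assoc P, ← Matrix.mul_assoc _ _ P,
        sqrt_mul_sqrt hτ.1, hPτ, sub_self, Matrix.mul_assoc P, ← Matrix.mul_assoc _ _ P,
        sqrt_mul_sqrt hτ.1, ← Matrix.mul_assoc, hPτ, sub_self, sub_self]
    rw [Matrix.self_mul_conjTranspose_eq_zero] at h1
    exact (sub_eq_zero.1 h1).symm
  -- `√τ` is fixed by its support projection `P`, so Cauchy–Schwarz bounds the squared fidelity by
  -- `tr P ρ = ∑ₓ dₓ pₓ`.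
  have hsum : 1 - ε ^ 2 ≤ ∑ x, d x * p x := by
    obtain ⟨Y, hY, hYF⟩ := traceNorm_exists (CFC.sqrt τ * CFC.sqrt ρ)
    have h1 : fidelity τ ρ = hs (CFC.sqrt τ) (P * CFC.sqrt ρ * Y) := by
      have : CFC.sqrt τ * P = CFC.sqrt τ := by
        have := congrArg Matrix.conjTranspose hPs
        rwa [Matrix.conjTranspose_mul, sqrt_conjTranspose, hP.eq] at this
      rw [fidelity, hYF, hs, sqrt_conjTranspose, ← Matrix.mul_assoc, ← Matrix.mul_assoc, this]
    have h2 := hs_le (CFC.sqrt τ) (P * CFC.sqrt ρ * Y)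
    rw [← h1] at h2
    have h3 : √(nsq (CFC.sqrt τ)) ≤ 1 := by
      rw [Real.sqrt_le_one, nsq_sqrt hτ.1]; exact hτ.2
    have h4 : nsq (P * CFC.sqrt ρ * Y) ≤ ∑ x, d x * p x := by
      refine (nsq_mul_contr_le _ hY).trans (le_of_eq ?_)
      rw [nsq_eq_trace, Matrix.conjTranspose_mul, hP.eq, sqrt_conjTranspose, Matrix.mul_assoc,
        ← Matrix.mul_assoc _ _ P, sqrt_mul_sqrt hρ0, Matrix.trace_mul_comm, Matrix.mul_assoc, hPP,
        Matrix.trace, Complex.re_sum]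
      refine Finset.sum_congr rfl fun x _ => ?_
      rw [Matrix.diag_apply, hρ, Matrix.diagonal_mul, Complex.re_ofReal_mul, mul_comm]
    have h5 : fidelity τ ρ ≤ √(∑ x, d x * p x) :=
      (h2.trans (mul_le_of_le_one_left (Real.sqrt_nonneg _) h3)).trans (Real.sqrt_le_sqrt h4)
    have h6 := pow_le_pow_left₀ (traceNorm_nonneg _ : 0 ≤ fidelity τ ρ) h5 2
    rw [Real.sq_sqrt (Finset.sum_nonneg fun x _ => mul_nonneg (hd0 x) (hp x))] at h6
    exact hF.trans h6
  -- The `dₓ` sum to the rank, so at most twice the rank of them reach `1/2`. Off this set `1 - dₓ >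
  -- 1/2`, so the lost weight is at most `2 ∑ₓ (1 - dₓ) pₓ`.
  refine ⟨?_, Finset.univ.filter fun x => 1 / 2 ≤ d x, ?_, ?_⟩
  · by_contra! h
    have h0 : ∑ x, d x = 0 := by rw [hdsum]; exact_mod_cast Nat.le_zero.1 h
    rw [Finset.sum_eq_zero_iff_of_nonneg fun x _ => hd0 x] at h0
    rw [Finset.sum_eq_zero fun x hx => by rw [h0 x hx, zero_mul]] at hsum
    linarith
  · have h1 : ((Finset.univ.filter fun x => 1 / 2 ≤ d x).card : ℝ) * (1 / 2) ≤ τ.rank := by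
      rw [← hdsum, ← nsmul_eq_mul]
      refine (Finset.card_nsmul_le_sum _ _ _ fun x hx => (Finset.mem_filter.1 hx).2).trans ?_
      exact Finset.sum_le_sum_of_subset_of_nonneg (Finset.filter_subset _ _) fun x _ _ => hd0 x
    have h2 : ((Finset.univ.filter fun x => 1 / 2 ≤ d x).card : ℝ) ≤ 2 * τ.rank := by linarith
    exact_mod_cast h2
  · have h1 : ∀ x, (1 - if 1 / 2 ≤ d x then 1 else 0) * p x ≤ 2 * (p x - d x * p x) := by
      intro x
      split_ifs with h
      · nlinarith [hp x, hd1 x]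
      · nlinarith [hp x]
    have h2 := Finset.sum_le_sum fun x (_ : x ∈ Finset.univ) => h1 x
    simp only [sub_mul, one_mul, ite_mul, zero_mul, Finset.sum_sub_distrib, ← Finset.mul_sum,
      ← Finset.sum_filter, hp1] at h2
    linarith

end Smoothing

/-! ### Reduced states and smoothing of the max-information -/

section Reduced

variable {A X R : Type*} [Fintype A] [DecidableEq A] [Fintype X] [DecidableEq X]
    [Fintype R] [DecidableEq R]

/-- The vector `∑ₓ |x x⟩ ⊗ Ψₓ` as an operator from `A X_A` to `X_A' R`. -/
noncomputable def reducedMat (Ψ : X → Matrix R A ℂ) : Matrix (X × R) (X × A) ℂ :=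
  Matrix.of fun i j => if j.1 = i.1 then Ψ i.1 i.2 j.2 else 0

theorem reducedXR_sourceVec (Ψ : X → Matrix R A ℂ) :
    reducedXR (Matrix.vecMulVec (sourceVec Ψ) (star (sourceVec Ψ)))
      = reducedMat Ψ * (reducedMat Ψ).conjTranspose := by
  ext ⟨x, r⟩ ⟨x', r'⟩
  simp only [reducedXR, traceLeft, Matrix.mul_apply, Matrix.vecMulVec_apply, Pi.star_apply,
    Matrix.conjTranspose_apply, Fintype.sum_prod_type]
  refine Finset.sum_congr rfl fun y _ => Finset.sum_congr rfl fun a _ => ?_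
  simp only [sourceVec, sourceMat, reducedMat, Matrix.of_apply]
  by_cases h1 : y = x
  · subst h1
    by_cases h2 : y = x'
    · subst h2; simp
    · simp [h2]
  · simp [h1]

/-- By classical coherence only the diagonal blocks of `C` overlap with the source, so the other
blocks can be dropped at no loss of fidelity. -/
theorem hs_reducedMat (C : Matrix (X × R) (X × A) ℂ) (Ψ : X → Matrix R A ℂ) :
    hs C (reducedMat Ψ) = ∑ x, hs (Matrix.of fun r a => C (x, r) (x, a)) (Ψ x) := by
  simp only [hs_eq_sum, Fintype.sum_prod_type]
  refine Finset.sum_congr rfl fun x _ => Finset.sum_congr rfl fun r _ => ?_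
  rw [Finset.sum_eq_single x]
  · simp [reducedMat]
  · intro y _ hy
    simp [reducedMat, hy]
  · simp

theorem reducedX_sourceVec (Ψ : X → Matrix R A ℂ) :
    reducedX (Matrix.vecMulVec (sourceVec Ψ) (star (sourceVec Ψ)))
      = Matrix.diagonal fun x => (nsq (Ψ x) : ℂ) := by
  ext x x'
  rw [reducedX, traceRight, reducedXR_sourceVec]
  simp only [Matrix.mul_apply, Matrix.conjTranspose_apply, Fintype.sum_prod_type, reducedMat,
    Matrix.of_apply]
  by_cases h : x = x'
  · subst h
    rw [Matrix.diagonal_apply_eq, nsq_eq_sum]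
    push_cast
    refine Finset.sum_congr rfl fun r _ => ?_
    rw [Finset.sum_eq_single x]
    · refine Finset.sum_congr rfl fun a _ => ?_
      rw [if_pos rfl, Complex.star_def, Complex.mul_conj, Complex.normSq_eq_norm_sq]
      push_cast
      rfl
    · intro y _ hy
      simp [hy]
    · simp
  · rw [Matrix.diagonal_apply_ne _ h]
    refine Finset.sum_eq_zero fun r _ => Finset.sum_eq_zero fun y _ => Finset.sum_eq_zero fun a _ =>
      ?_
    by_cases hy : y = x
    · subst hy; simp [h]
    · simp [hy]

theorem traceRight_apply {m k : Type*} [Fintype k] (τ : Op (m × k)) (i j : m) :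
    traceRight τ i j = ∑ r, τ (i, r) (j, r) := rfl

theorem trace_traceRight {m k : Type*} [Fintype m] [Fintype k] (τ : Op (m × k)) :
    (traceRight τ).trace = τ.trace := by
  simp [Matrix.trace, traceRight, Fintype.sum_prod_type]

/-- An operator that is feasible for the smooth max-information, as a family of vectors close to
the source. -/
theorem exists_dominated_vectors {Ψ : X → Matrix R A ℂ} (hΨ : ∑ x, nsq (Ψ x) = 1) {ε l : ℝ}
    (hε : 0 ≤ ε) (hε1 : ε < 1) {τ : Op (X × R)}
    (hτ : τ ∈ smoothingBall ε (reducedXR (Matrix.vecMulVec (sourceVec Ψ) (star (sourceVec Ψ)))))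
    {σ : Op R} (hσ : IsState σ) (h : (((2 : ℝ) ^ l) • (traceRight τ ⊗ₖ σ) - τ).PosSemidef) :
    0 ≤ l ∧ ∃ (Θ : X → Matrix R A ℂ) (q : X → ℝ), (∀ x, 0 ≤ q x) ∧ ∑ x, q x ≤ 1 ∧
      (∀ x, Θ x * (Θ x).conjTranspose ≤ ((2 : ℝ) ^ l * q x) • σ) ∧ ∑ x, nsq (Θ x) ≤ 1 ∧
      ∑ x, nsq (Ψ x - Θ x) ≤ 2 * ε ^ 2 := by
  set ρ := reducedXR (Matrix.vecMulVec (sourceVec Ψ) (star (sourceVec Ψ))) with hρ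
  have hρB : reducedMat Ψ * (reducedMat Ψ).conjTranspose = ρ := (reducedXR_sourceVec Ψ).symm
  have hρ0 : ρ.PosSemidef := hρB ▸ Matrix.posSemidef_self_mul_conjTranspose _
  have hnB : nsq (reducedMat Ψ) = 1 := by
    rw [nsq, hs_reducedMat, ← hΨ]
    refine Finset.sum_congr rfl fun x _ => ?_
    rw [nsq]; congr 1; ext r a; simp [reducedMat]
  have hρs : IsState ρ := by
    refine ⟨hρ0, Complex.ext ?_ ?_⟩
    · rw [← hρB, ← nsq_eq_trace, hnB]; simp
    · simpa using (Complex.nonneg_iff.1 hρ0.trace_nonneg).2.symm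
  have hτ0 := hτ.1.1
  obtain ⟨C, hC, hCF⟩ := exists_hs_eq_fidelity hρ0 hτ0 hρB
  have hF := le_fidelity_of_mem_ball hε hρs hτ
  have hCτ : nsq C ≤ τ.trace.re := by
    rw [nsq_eq_trace]; exact trace_re_mono hC
  have htr0 : 0 < τ.trace.re := by
    by_contra! h0
    have h1 := hs_le C (reducedMat Ψ)
    rw [hCF, hnB, Real.sqrt_eq_zero_of_nonpos (hCτ.trans h0), zero_mul] at h1
    nlinarith
  refine ⟨?_, fun x => Matrix.of fun r a => C (x, r) (x, a), fun x => (traceRight τ x x).re,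
    fun x => ?_, ?_, fun x => ?_, ?_, ?_⟩
  -- Taking traces gives `tr τ ≤ 2^l tr τ`, and `tr τ > 0` because `ε < 1`.
  · have h1 := posSemidef_trace_re_nonneg h
    rw [Matrix.trace_sub, Matrix.trace_smul, Matrix.trace_kronecker, trace_traceRight, hσ.2,
      mul_one, Complex.sub_re, Complex.real_smul, Complex.re_ofReal_mul] at h1
    have h2 : 1 ≤ (2 : ℝ) ^ l := by
      by_contra! h3
      nlinarith
    by_contra! h3
    exact absurd h2 (not_le.2 (Real.rpow_lt_one_of_one_lt_of_neg one_lt_two h3))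
  · change 0 ≤ (∑ r, τ (x, r) (x, r)).re
    rw [Complex.re_sum]
    exact Finset.sum_nonneg fun r _ => (Complex.nonneg_iff.1 hτ0.diag_nonneg).1
  · have : ∑ x, (traceRight τ x x).re = τ.trace.re := by
      rw [← trace_traceRight, Matrix.trace, Complex.re_sum]
      rfl
    rw [this]; exact hτ.1.2
  · have h1 : τ.submatrix (fun r => (x, r)) (fun r => (x, r))
        ≤ ((2 : ℝ) ^ l * (traceRight τ x x).re) • σ := by
      have him : traceRight τ x x = ((traceRight τ x x).re : ℂ) := by
        refine Complex.ext rfl ?_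
        rw [traceRight_apply, Complex.im_sum, Complex.ofReal_im]
        exact Finset.sum_eq_zero fun r _ => (Complex.nonneg_iff.1 hτ0.diag_nonneg).2.symm
      have h2 : ((2 : ℝ) ^ l * (traceRight τ x x).re) • σ
            - τ.submatrix (fun r => (x, r)) (fun r => (x, r))
          = (((2 : ℝ) ^ l) • (traceRight τ ⊗ₖ σ) - τ).submatrix
            (fun r => (x, r)) (fun r => (x, r)) := by
        ext r r'
        simp only [Matrix.sub_apply, Matrix.smul_apply, Matrix.submatrix_apply,
          Matrix.kroneckerMap_apply]
        rw [him]
        simp only [Complex.real_smul, Complex.ofReal_re]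
        push_cast
        ring
      rw [Matrix.le_iff, h2]
      exact h.submatrix _
    refine le_trans ?_ h1
    have h3 : (C * C.conjTranspose).submatrix (fun r => (x, r)) (fun r => (x, r))
        ≤ τ.submatrix (fun r => (x, r)) (fun r => (x, r)) := by
      rw [Matrix.le_iff] at hC ⊢
      exact hC.submatrix fun r : R => (x, r)
    refine le_trans ?_ h3
    have h4 : (C * C.conjTranspose).submatrix (fun r => (x, r)) (fun r => (x, r))
        = ∑ y, (Matrix.of fun r a => C (x, r) (y, a)) *
          (Matrix.of fun r a => C (x, r) (y, a)).conjTranspose := by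
      ext r r'
      simp [Matrix.mul_apply, Matrix.sum_apply, Fintype.sum_prod_type]
    rw [h4]
    exact Finset.single_le_sum (f := fun y => (Matrix.of fun r a => C (x, r) (y, a)) *
      (Matrix.of fun r a => C (x, r) (y, a)).conjTranspose)
      (fun y _ => mul_conjTranspose_nonneg _) (Finset.mem_univ x)
  · refine le_trans ?_ (hCτ.trans hτ.1.2)
    simp only [nsq_eq_sum, Fintype.sum_prod_type, Matrix.of_apply]
    refine Finset.sum_le_sum fun x _ => Finset.sum_le_sum fun r _ => ?_
    exact Finset.single_le_sum (f := fun y => ∑ a, ‖C (x, r) (y, a)‖ ^ 2)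
      (fun y _ => Finset.sum_nonneg fun a _ => sq_nonneg _) (Finset.mem_univ x)
  · have h2 : ∑ x, nsq (Matrix.of fun r a => C (x, r) (x, a)) ≤ 1 := by
      refine le_trans ?_ (hCτ.trans hτ.1.2)
      simp only [nsq_eq_sum, Fintype.sum_prod_type, Matrix.of_apply]
      refine Finset.sum_le_sum fun x _ => Finset.sum_le_sum fun r _ => ?_
      exact Finset.single_le_sum (f := fun y => ∑ a, ‖C (x, r) (y, a)‖ ^ 2)
        (fun y _ => Finset.sum_nonneg fun a _ => sq_nonneg _) (Finset.mem_univ x)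
    simp only [nsq_sub, Finset.sum_add_distrib, Finset.sum_sub_distrib, ← Finset.mul_sum, hΨ]
    have h3 : ∑ x, hs (Ψ x) (Matrix.of fun r a => C (x, r) (x, a)) = fidelity τ ρ := by
      rw [← hCF, hs_reducedMat]
      exact Finset.sum_congr rfl fun x _ => hs_comm _ _
    rw [h3]
    linarith

end Reduced

/-! ### The two protocols and the choice of parameters -/

section Main

variable {A X R : Type*} [Fintype A] [DecidableEq A] [Fintype X] [DecidableEq X]
    [Fintype R] [DecidableEq R]

/-- The protocol without shared randomness that sends the values in `T`. -/
theorem exists_direct_protocol {Ψ : X → Matrix R A ℂ} (hΨ : ∑ x, nsq (Ψ x) = 1) [Nonempty A]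
    [Nonempty X] {ε ε' : ℝ} (hε : 0 ≤ ε) (hε' : 0 ≤ ε') {T : Finset X} {c : ℕ}
    (hT : T.card ≤ 2 ^ c) (hTp : 1 - ∑ x ∈ T, nsq (Ψ x) ≤ 2 * ε' ^ 2) :
    ∃ P : Protocol A X c 1, P.IsClassicalStateSplitting
      (Matrix.vecMulVec (sourceVec Ψ) (star (sourceVec Ψ))) (ε + √14 * ε') := by
  obtain ⟨x₀⟩ := ‹Nonempty X›
  -- Each value in `T` gets exactly one cell of the single block, so for `Ψ` restricted to `T` the
  -- covering is exact.
  obtain ⟨f, hf⟩ := exists_fun_card_fiber (Y := Bits c × Fin 1) (fun x => if x ∈ T then 1 else 0)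
    (by simpa using hT)
  refine exists_protocol_purifiedDistance_le (T := T) (Θ := fun x => if x ∈ T then Ψ x else 0)
    (g := fun y => (f y).getD x₀) (w := fun y => (f y).elim 0 fun _ => 1) one_pos hε hε'
    (fun y => ?_) (fun x => ?_) (fun x hx => if_neg hx) hΨ hTp ?_ ?_
  · cases f y <;> simp
  · rw [sum_option_fiber hf (F := fun o => if o.getD x₀ = x then o.elim (0 : ℝ) fun _ => 1 else 0)
      (by simp), Finset.sum_eq_single x]
    · simp
    · intro y _ hy
      simp [hy]
    · simp
  · rw [Finset.sum_eq_zero]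
    · positivity
    · intro x hx
      simp [hx, nsq, hs]
  · set F : Option X → Op R := fun o => o.elim 0 fun x => if x ∈ T then
      Ψ x * (Ψ x).conjTranspose else 0 with hF
    have h1 := sum_option_fiber hf (F := F) rfl
    have h2 : ∑ x, (if x ∈ T then Ψ x else 0) * (if x ∈ T then Ψ x else 0).conjTranspose
        = ∑ y, F (f y) := by
      rw [h1]
      refine Finset.sum_congr rfl fun x _ => ?_
      by_cases hx : x ∈ T <;> simp [hF, hx]
    have h3 : ∀ b, ∑ k, (((1 : ℕ) : ℝ) * (f (k, b)).elim 0 fun _ => 1) •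
        ((if (f (k, b)).getD x₀ ∈ T then Ψ ((f (k, b)).getD x₀) else 0) *
          (if (f (k, b)).getD x₀ ∈ T then Ψ ((f (k, b)).getD x₀) else 0).conjTranspose)
        = ∑ y, F (f y) := by
      intro b
      rw [Fintype.sum_prod_type]
      refine Finset.sum_congr rfl fun k _ => ?_
      rw [Fintype.sum_unique, Subsingleton.elim b default]
      cases f (k, default) with
      | none => simp [hF]
      | some x => by_cases hx : x ∈ T <;> simp [hF, hx]
    simp only [h2, h3, sub_self]
    simp [nsq, hs]
    positivity

/-- The protocol with shared randomness, for a source whose conditional states are nearly dominated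
by a state. -/
theorem exists_shared_protocol {Ψ Θ : X → Matrix R A ℂ} (hΨ : ∑ x, nsq (Ψ x) = 1) [Nonempty A]
    [Nonempty X] {ε ε' l : ℝ} (hε : 0 < ε) (hε' : 0 ≤ ε') {T : Finset X} {c S : ℕ} (hS : 0 < S)
    (hTp : 1 - ∑ x ∈ T, nsq (Ψ x) ≤ 2 * ε' ^ 2) {σ : Op R} (hσ : IsState σ) {q : X → ℝ}
    (hq : ∀ x, 0 ≤ q x) (hq1 : ∑ x, q x ≤ 1)
    (hΘ : ∀ x, Θ x * (Θ x).conjTranspose ≤ ((2 : ℝ) ^ l * q x) • σ) (hΘ1 : ∑ x, nsq (Θ x) ≤ 1)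
    (hΨΘ : ∑ x, nsq (Ψ x - Θ x) ≤ 2 * ε' ^ 2)
    (hT : T.card + S * ((2 : ℝ) ^ l / ε ^ 4) ≤ 2 ^ c * S) :
    ∃ P : Protocol A X c S, P.IsClassicalStateSplitting
      (Matrix.vecMulVec (sourceVec Ψ) (star (sourceVec Ψ))) (ε + √14 * ε') := by
  have hl : (0 : ℝ) < 2 ^ l := Real.rpow_pos_of_pos two_pos l
  set κ := (2 : ℝ) ^ l / ε ^ 4 with hκ
  have hκ0 : 0 < κ := by positivity
  have hS0 : (0 : ℝ) < S := Nat.cast_pos.2 hS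
  have hle : ∀ x, (if x ∈ T then Θ x else 0) * (if x ∈ T then Θ x else 0).conjTranspose
      ≤ Θ x * (Θ x).conjTranspose := by
    intro x
    split_ifs
    · exact le_rfl
    · simpa using mul_conjTranspose_nonneg (Θ x)
  -- The maximum with `1` gives every value of `T` a cell even when `qₓ = 0`; rounding up costs at
  -- most one cell for each value of `T`.
  set n : X → ℕ := fun x => if x ∈ T then max ⌈q x * (S * κ)⌉₊ 1 else 0 with hn
  have hnle : ∀ x, (n x : ℝ) ≤ (if x ∈ T then 1 else 0) + q x * (S * κ) := by
    intro x
    have h0 : 0 ≤ q x * (S * κ) := mul_nonneg (hq x) (by positivity)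
    simp only [hn]
    split_ifs
    · rw [Nat.cast_max]
      refine max_le ?_ (by simpa using h0)
      linarith [(Nat.ceil_lt_add_one h0).le]
    · simpa using h0
  have hnsum : ∑ x, n x ≤ Fintype.card (Bits c × Fin S) := by
    have h1 : (∑ x, n x : ℝ) ≤ T.card + S * κ := by
      refine (Finset.sum_le_sum fun x _ => hnle x).trans ?_
      rw [Finset.sum_add_distrib, ← Finset.sum_mul]
      have h2 : (∑ x, q x) * (S * κ) ≤ S * κ := mul_le_of_le_one_left (by positivity) hq1
      simpa using h2
    have h3 : (∑ x, n x : ℝ) ≤ 2 ^ c * S := h1.trans hT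
    simp only [Fintype.card_prod, Fintype.card_fun, Fintype.card_bool, Fintype.card_fin]
    exact_mod_cast h3
  obtain ⟨g, w, hw, hwT, hcov⟩ := exists_covering_code (c := c)
    (Θ := fun x => if x ∈ T then Θ x else 0) (T := T) (n := n) hσ hS hq hl.le hκ0
    (fun x => (hle x).trans (hΘ x))
    (le_trans (Finset.sum_le_sum fun x _ => by
      split_ifs
      · exact le_rfl
      · simpa [nsq, hs] using nsq_nonneg (Θ x)) hΘ1)
    (fun x hx => if_neg hx) (fun x => by by_cases hx : x ∈ T <;> simp [hn, hx]) hnsum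
    (fun x hx => by
      simp only [hn, if_pos hx]
      exact (Nat.le_ceil _).trans (by exact_mod_cast le_max_left _ _))
  refine exists_protocol_purifiedDistance_le hS hε.le hε' hw hwT (fun x hx => if_neg hx) hΨ hTp ?_
    (hcov.trans (le_of_eq ?_))
  · refine le_trans ?_ hΨΘ
    refine le_trans (Finset.sum_le_sum fun x hx => ?_)
      (Finset.sum_le_sum_of_subset_of_nonneg (Finset.subset_univ T) fun x _ _ => nsq_nonneg _)
    simp [hx]
  -- The choice of `κ` makes `√(2^l / κ)` equal to `ε²`.
  · rw [hκ, div_div_cancel₀ hl.ne', show ε ^ 4 = (ε ^ 2) ^ 2 by ring,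
      Real.sqrt_sq (by positivity)]

theorem randomnessCost_two_pow (s : ℕ) : randomnessCost (2 ^ s) = s := by
  rw [randomnessCost, Nat.cast_pow, Nat.cast_ofNat, Real.logb_pow,
    Real.logb_self_eq_one one_lt_two, mul_one, Nat.ceil_natCast]

theorem le_two_pow_ceil_logb {y : ℝ} (hy : 0 < y) : y ≤ 2 ^ ⌈Real.logb 2 y⌉₊ := by
  rw [← Real.rpow_natCast]
  calc y = 2 ^ Real.logb 2 y := (Real.rpow_logb two_pos (by norm_num) hy).symm
    _ ≤ _ := Real.rpow_le_rpow_of_exponent_le one_le_two (Nat.le_ceil _)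

/-- `√14 ≤ 3.8`, and `2.8 ε' ≤ √(8 ε')` because `2.8² = 7.84 ≤ 8` and `ε' ≤ 1`. The term in the
dimension of `X` enters only through its sign. -/
theorem error_le {ε ε' k : ℝ} (hε' : 0 ≤ ε') (hε'1 : ε' < 1) (hk : 0 ≤ k) :
    ε + √14 * ε' ≤ ε + ε' + √(8 * ε') + k := by
  have h1 : √14 ≤ 1 + 2.8 := by rw [Real.sqrt_le_left (by norm_num)]; norm_num
  have h2 : 2.8 * ε' ≤ √(8 * ε') := by
    apply Real.le_sqrt_of_sq_le
    nlinarith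
  nlinarith

end Main

end StateSplitting

open StateSplitting
theorem mainTheorem3 {A X R : Type*} [Fintype A] [DecidableEq A] [Fintype X] [DecidableEq X]
    [Fintype R] [DecidableEq R] (hX : 2 ≤ Fintype.card X)
    (ε ε' : ℝ) (hε : 0 < ε) (hε1 : ε ≤ 1) (hε' : 0 ≤ ε') (hε'1 : ε' < 1)
    (ρ : Op (A × X × X × R)) (hρ : IsPureState ρ) (hcc : IsClassicallyCoherent ρ) :
    ∃ (c S : ℕ) (_ : 0 < S) (P : Protocol A X c S),
      P.IsClassicalStateSplitting ρ
        (ε + ε' + Real.sqrt (8 * ε') + (Fintype.card X : ℝ) ^ (-(1 / 2) : ℝ)) ∧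
      ((c : ℝ) : EReal) ≤ smoothIMax ε' (reducedXR ρ) +
        ((4 * Real.logb 2 (1 / ε) + 4 + Real.logb 2 (Real.logb 2 (Fintype.card X)) : ℝ) : EReal) ∧
      ((c + randomnessCost S : ℝ) : EReal) ≤ smoothHZero ε' (reducedX ρ) +
        ((2 + Real.logb 2 (Real.logb 2 (Fintype.card X)) : ℝ) : EReal) := by
  obtain ⟨p, ψ, hp, hp1, hψ, hρv⟩ := hcc
  set Ψ : X → Matrix R A ℂ := fun x => Matrix.of fun r a => (√(p x) : ℂ) * ψ x (a, r) with hΨdef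
  have hΨp : ∀ x, nsq (Ψ x) = p x := by
    intro x
    rw [nsq_eq_sum, Finset.sum_comm, ← mul_one (p x), ← hψ x, Fintype.sum_prod_type,
      Finset.mul_sum]
    refine Finset.sum_congr rfl fun a _ => ?_
    rw [Finset.mul_sum]
    refine Finset.sum_congr rfl fun r _ => ?_
    simp [hΨdef, mul_pow, Real.sq_sqrt (hp x)]
  have hΨ1 : ∑ x, nsq (Ψ x) = 1 := by simp only [hΨp, hp1]
  obtain rfl : ρ = Matrix.vecMulVec (sourceVec Ψ) (star (sourceVec Ψ)) := hρv
  have hcard : 0 < Fintype.card X := by omega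
  have : Nonempty X := Fintype.card_pos_iff.1 hcard
  have : Nonempty A := by
    by_contra h
    rw [not_nonempty_iff] at h
    simp [nsq, hs, Matrix.trace, Matrix.mul_apply] at hΨ1
  have hk : 0 ≤ (Fintype.card X : ℝ) ^ (-(1 / 2) : ℝ) := by positivity
  have herr := error_le (ε := ε) hε' hε'1 hk
  set I := smoothIMax ε' (reducedXR (Matrix.vecMulVec (sourceVec Ψ) (star (sourceVec Ψ)))) with hI
  set H := smoothHZero ε' (reducedX (Matrix.vecMulVec (sourceVec Ψ) (star (sourceVec Ψ)))) with hH
  set ll := Real.logb 2 (Real.logb 2 (Fintype.card X)) with hll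
  have hlog1 : 1 ≤ Real.logb 2 (Fintype.card X) := by
    rw [Real.le_logb_iff_rpow_le one_lt_two (by exact_mod_cast hcard)]
    simpa using (by exact_mod_cast hX : (2 : ℝ) ≤ Fintype.card X)
  have hll0 : 0 ≤ ll := Real.logb_nonneg one_lt_two hlog1
  have hlε : 0 ≤ Real.logb 2 (1 / ε) :=
    Real.logb_nonneg one_lt_two ((one_le_div hε).2 hε1)
  have hstate : IsState (Matrix.diagonal fun x => (nsq (Ψ x) : ℂ)) := by
    refine ⟨Matrix.PosSemidef.diagonal fun x => by simpa using nsq_nonneg (Ψ x), ?_⟩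
    rw [Matrix.trace_diagonal, ← Complex.ofReal_sum, hΨ1, Complex.ofReal_one]
  have hεsq : ε' ^ 2 < 1 := by nlinarith
  have hrank : ∀ τ ∈ smoothingBall ε' (Matrix.diagonal fun x => (nsq (Ψ x) : ℂ)), 0 < τ.rank ∧
      ∃ T : Finset X, T.card ≤ 2 * τ.rank ∧ 1 - ∑ x ∈ T, nsq (Ψ x) ≤ 2 * ε' ^ 2 := fun τ hτ =>
    exists_finset_of_rank (fun x => nsq_nonneg _) hτ.1 hεsq hΨ1
      (le_fidelity_sq_of_mem_ball hε' hstate hτ)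
  -- Ranks are natural numbers, so the infimum defining the smooth zero-entropy is attained.
  obtain ⟨τ₀, hτ₀, hmin⟩ : ∃ τ ∈ smoothingBall ε' (Matrix.diagonal fun x => (nsq (Ψ x) : ℂ)),
      ∀ τ' ∈ smoothingBall ε' (Matrix.diagonal fun x => (nsq (Ψ x) : ℂ)), τ.rank ≤ τ'.rank :=
    exists_minimalFor_of_wellFoundedLT _ _ ⟨_, self_mem_ball hε' hstate⟩ |>.imp fun τ h =>
      ⟨h.1, fun τ' hτ' => (le_total τ.rank τ'.rank).elim id fun h' => h.2 hτ' h'⟩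
  obtain ⟨hr0, T, hT, hTp⟩ := hrank τ₀ hτ₀
  set r := τ₀.rank with hr
  have hr0' : (0 : ℝ) < r := Nat.cast_pos.2 hr0
  have hlr : 0 ≤ Real.logb 2 r := Real.logb_nonneg one_lt_two (by exact_mod_cast hr0)
  have hHr : ((Real.logb 2 r : ℝ) : EReal) ≤ H := by
    rw [hH, reducedX_sourceVec]
    refine le_iInf₂ fun τ hτ => ?_
    rw [hZero, if_neg (hrank τ hτ).1.ne', EReal.coe_le_coe_iff]
    exact Real.logb_le_logb_of_le one_lt_two hr0' (by exact_mod_cast hmin τ hτ)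
  have hsecond : ∀ y : ℝ, y ≤ Real.logb 2 r + (2 + ll) → (y : EReal) ≤ H + ((2 + ll : ℝ) : EReal) :=
    fun y hy => (EReal.coe_le_coe_iff.2 hy).trans
      (by rw [EReal.coe_add]; exact add_le_add hHr le_rfl)
  -- If sending an element of `T` directly already meets the bound on `c`, no shared randomness is
  -- needed.
  by_cases hcase : ((Real.logb 2 r + 2 : ℝ) : EReal)
      ≤ I + ((4 * Real.logb 2 (1 / ε) + 4 + ll : ℝ) : EReal)
  · set c := ⌈Real.logb 2 (2 * r)⌉₊ with hc
    have hlog : Real.logb 2 (2 * r) = 1 + Real.logb 2 r := by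
      rw [Real.logb_mul two_ne_zero hr0'.ne', Real.logb_self_eq_one one_lt_two]
    have hcle : (c : ℝ) ≤ Real.logb 2 r + 2 := by
      have := (Nat.ceil_lt_add_one (by rw [hlog]; linarith : 0 ≤ Real.logb 2 (2 * r))).le
      rw [hlog] at this
      rw [hc, hlog]; linarith
    have hTc : T.card ≤ 2 ^ c := by
      have h1 : (2 * r : ℝ) ≤ 2 ^ c := le_two_pow_ceil_logb (by positivity)
      have h2 : (T.card : ℝ) ≤ 2 * r := by exact_mod_cast hT
      exact_mod_cast h2.trans h1
    obtain ⟨P, hP⟩ := exists_direct_protocol hΨ1 hε.le hε' hTc hTp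
    refine ⟨c, 1, one_pos, P, le_trans hP herr, (EReal.coe_le_coe_iff.2 hcle).trans hcase,
      hsecond _ ?_⟩
    simp [randomnessCost]
    linarith
  · rw [not_le] at hcase
    have hfeas : ∀ (τ : Op (X × R)), τ ∈ smoothingBall ε' (reducedXR
        (Matrix.vecMulVec (sourceVec Ψ) (star (sourceVec Ψ)))) → ∀ σ : Op R, IsState σ →
        ∀ l : ℝ, (((2 : ℝ) ^ l) • (traceRight τ ⊗ₖ σ) - τ).PosSemidef → 0 ≤ l ∧
        ∃ (Θ : X → Matrix R A ℂ) (q : X → ℝ), (∀ x, 0 ≤ q x) ∧ ∑ x, q x ≤ 1 ∧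
          (∀ x, Θ x * (Θ x).conjTranspose ≤ ((2 : ℝ) ^ l * q x) • σ) ∧ ∑ x, nsq (Θ x) ≤ 1 ∧
          ∑ x, nsq (Ψ x - Θ x) ≤ 2 * ε' ^ 2 := fun τ hτ σ hσ l h =>
      exists_dominated_vectors hΨ1 hε' hε'1 hτ hσ h
    have hI0 : 0 ≤ I := le_iInf₂ fun τ hτ => le_iInf₂ fun σ hσ => le_iInf₂ fun l hl =>
      EReal.coe_nonneg.2 (hfeas τ hτ σ hσ l hl).1
    have hItop : I ≠ ⊤ := by
      intro h
      rw [h, EReal.top_add_coe] at hcase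
      exact not_top_lt hcase
    obtain ⟨i, hi⟩ : ∃ i : ℝ, I = i :=
      ⟨I.toReal, (EReal.coe_toReal hItop (ne_bot_of_le_ne_bot (by simp) hI0)).symm⟩
    rw [hi, ← EReal.coe_add, EReal.coe_lt_coe_iff] at hcase
    have hi0 : 0 ≤ i := by rw [hi] at hI0; exact EReal.coe_nonneg.1 hI0
    -- The infimum need not be attained; one bit of slack in the bound on `c` pays for a feasible `l
    -- < i + 1`.
    have hlt : I < ((i + 1 : ℝ) : EReal) := by rw [hi, EReal.coe_lt_coe_iff]; linarith
    rw [hI] at hlt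
    simp only [smoothIMax, iMax, dMax, iInf_lt_iff, EReal.coe_lt_coe_iff] at hlt
    obtain ⟨τ, hτ, σ, hσ, l, hl, hli⟩ := hlt
    obtain ⟨hl0, Θ, q, hq, hq1, hΘ, hΘ1, hΨΘ⟩ := hfeas τ hτ σ hσ l hl
    set κ := (2 : ℝ) ^ l / ε ^ 4 with hκ
    have hκ0 : 0 < κ := by positivity
    have hlκ : Real.logb 2 (2 * κ) = 1 + l + 4 * Real.logb 2 (1 / ε) := by
      rw [hκ, Real.logb_mul two_ne_zero (by positivity), Real.logb_div (by positivity)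
        (by positivity), Real.logb_rpow two_pos (by norm_num), Real.logb_self_eq_one one_lt_two,
        Real.logb_pow, one_div, Real.logb_inv]
      push_cast; ring
    -- Half of the table is reserved for the `S κ` cells of the covering.
    set c := ⌈Real.logb 2 (2 * κ)⌉₊ with hc
    have hc1 : (c : ℝ) ≤ l + 4 * Real.logb 2 (1 / ε) + 2 := by
      have := (Nat.ceil_lt_add_one (by rw [hlκ]; linarith : 0 ≤ Real.logb 2 (2 * κ))).le
      rw [← hc, hlκ] at this
      linarith
    have hc2 : 2 * κ ≤ 2 ^ c := le_two_pow_ceil_logb (by positivity)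
    -- This makes the table have at least `4 r` cells, so its other half holds the at most `2 r`
    -- cells lost to rounding. By `hcase` the logarithm is nonnegative, so the ceiling loses at most
    -- one bit.
    set s := ⌈Real.logb 2 (4 * r / 2 ^ c)⌉₊ with hs
    have hls : Real.logb 2 (4 * r / 2 ^ c) = 2 + Real.logb 2 r - c := by
      rw [Real.logb_div (by positivity) (by positivity), Real.logb_mul (by norm_num) hr0'.ne',
        Real.logb_pow, Real.logb_self_eq_one one_lt_two,
        show (4 : ℝ) = 2 ^ 2 by norm_num, Real.logb_pow, Real.logb_self_eq_one one_lt_two]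
      push_cast; ring
    have hs1 : (s : ℝ) ≤ 3 + Real.logb 2 r - c := by
      have := (Nat.ceil_lt_add_one
        (by rw [hls]; linarith : 0 ≤ Real.logb 2 (4 * r / 2 ^ c))).le
      rw [← hs, hls] at this
      linarith
    have hs2 : 4 * r / 2 ^ c ≤ (2 : ℝ) ^ s := le_two_pow_ceil_logb (by positivity)
    -- The failed case forces `log r ≥ 2`, hence `log |X| ≥ 2`. The double logarithm thus absorbs
    -- the rounding bit in `c + s ≤ 3 + log r`.
    have hll1 : 1 ≤ ll := by
      have h1 : Real.logb 2 r ≤ Real.logb 2 (Fintype.card X) :=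
        Real.logb_le_logb_of_le one_lt_two hr0' (by exact_mod_cast τ₀.rank_le_card_width)
      rw [hll, Real.le_logb_iff_rpow_le one_lt_two (by linarith), Real.rpow_one]
      linarith
    have hcount : T.card + (2 ^ s : ℕ) * κ ≤ 2 ^ c * ((2 ^ s : ℕ) : ℝ) := by
      have h2 : (T.card : ℝ) ≤ 2 * r := by exact_mod_cast hT
      rw [div_le_iff₀ (by positivity)] at hs2
      have h3 := mul_le_mul_of_nonneg_left hc2 (by positivity : (0 : ℝ) ≤ 2 ^ s)
      push_cast
      linarith
    obtain ⟨P, hP⟩ := exists_shared_protocol hΨ1 hε hε' (pow_pos two_pos s) hTp hσ hq hq1 hΘ hΘ1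
      hΨΘ hcount
    refine ⟨c, 2 ^ s, pow_pos two_pos s, P, le_trans hP herr, ?_, hsecond _ ?_⟩
    · rw [hi, ← EReal.coe_add, EReal.coe_le_coe_iff]
      linarith
    · rw [randomnessCost_two_pow]
      linarith
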